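/- Let $k$ be a finite field with $q$ elements, let $K$ be a field containing $k$, and let $\theta\in K$ be the image of $t$ under a fixed $k$-algebra homomorphism $k[t]\to K$. Let $K[t,\sigma]$ be the ring of polynomials in $t$ and $\sigma$ over $K$ with $t\sigma=\sigma t$, $tx=xt$ and $\sigma x=x^q\sigma$ for $x\in K$; the ring $K[t]$ is a left $K[t,\sigma]$-module on which $\sigma$ acts by $\sum_i x_i t^i\mapsto\sum_i x_i^q t^i$. For a $k[t]$-module scheme $E$ over $K$ let $M_E$ be the group of homomorphisms $E\to\mathbf{G}_a$ of $k$-vector space schemes over $K$. It is a left $K[t,\sigma]$-module: $K$ acts through $\mathbf{G}_a$, $t$ through $E$, and $\sigma$ by composition with the $q$-th power Frobenius of $\mathbf{G}_a$. The scheme $E$ is called an abelian $t$-module if (1) for some $d\ge 0$ the $k$-vector space schemes $E_{\bar K}$ and $\mathbf{G}_{a,\bar K}^d$ are isomorphic, (2) $t-\theta$ acts nilpotently on $\mathrm{Lie}(E)$, and (3) $M_E$ is finitely generated as a $K[t]$-module. Then $M_E$ is the effective $t$-motif associated with $E$. Corollary. For every abelian $t$-module $E$ over $K$ there is an isomorphism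 of $k[t]$-modules $$\Phi_E\colon E(K)\;\cong\;\mathrm{Ext}^1_{K[t,\sigma]}(M_E,K[t]),$$ with $\mathrm{Ext}^1$ taken in the category of left $K[t,\sigma]$-modules. The isomorphism is natural: it is functorial in $E$ for homomorphisms of $k[t]$-module schemes (a homomorphism $E\to F$ acts on the right-hand side by pulling extensions back along $M_F\to M_E$), and it is compatible with field extensions $K\to K'$ (if $\Phi_E(x)$ is the class of an extension $0\to K[t]\to M\to M_E\to 0$, then $\Phi_{E_{K'}}$ sends the image of $x$ in $E_{K'}(K')$ to the class of its base change $0\to K'[t]\to M'\to M_{E_{K'}}\to 0$). -/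

import Mathlib

open CategoryTheory AlgebraicGeometry Polynomial

universe u

namespace TMotif

noncomputable section

/-! ### The ring `K[t,σ]` and its modules

Throughout, `k` is a finite field with `q` elements, and `K` is a field containing `k`. The variable
`t` is the variable `X` of the polynomial rings `k[X]` and `K[X]`. -/

section Ring

variable (k K : Type u) [Field k] [Fintype k] [Field K] [Algebra k K]

/-- The endomorphism `τ` of `K[t]`: the `q`-th power map on `K`, and `τ t = t`. -/
def tau : K[X] →+* K[X] :=
  Polynomial.mapRingHom (FiniteField.frobeniusAlgHom k K : K →+* K)

/-- The action of the powers of `τ` on `K[t]`. -/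
@[reducible] def tauAction : MulSemiringAction (Multiplicative ℕ) K[X] :=
  MulSemiringAction.compHom K[X] (powersHom (K[X] →+* K[X]) (tau k K))

/-- The ring `K[t,σ]` of polynomials `∑ aᵢ σⁱ` with `aᵢ ∈ K[t]`; the multiplication satisfies
`t σ = σ t`, `t x = x t` and `σ x = x ^ q σ` for `x ∈ K`. -/
def SkewRing (_k K : Type u) [Field K] : Type u := SkewPolynomial K[X]

instance : Ring (SkewRing k K) :=
  letI := tauAction k K
  inferInstanceAs (Ring (SkewPolynomial K[X]))

namespace SkewRing

/-- The inclusion of `K[t]` into `K[t,σ]`. -/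
def ofPoly : K[X] →+* SkewRing k K :=
  letI := tauAction k K
  (SkewPolynomial.CRingHom : K[X] →+* SkewPolynomial K[X])

/-- The element `σ` of `K[t,σ]`. -/
def sigma : SkewRing k K := (SkewPolynomial.X : SkewPolynomial K[X])

variable {k K}

/-- A ring homomorphism out of `K[t,σ]` from one out of `K[t]` and an image of `σ`. -/
def lift {B : Type*} [Ring B] (f : K[X] →+* B) (s : B) (h : ∀ p, s * f p = f (tau k K p) * s) :
    SkewRing k K →+* B :=
  letI := tauAction k K
  SkewMonoidAlgebra.liftNCRingHom f (powersHom B s) (by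
    intro p n
    change f ((((tau k K) ^ (Multiplicative.toAdd n) : K[X] →+* K[X])) p) *
        s ^ (Multiplicative.toAdd n) = s ^ (Multiplicative.toAdd n) * f p
    generalize Multiplicative.toAdd n = m
    induction m generalizing p with
    | zero => simp
    | succ m ih =>
      rw [pow_succ (tau k K), pow_succ s, RingHom.mul_def, RingHom.comp_apply, ← mul_assoc, ih,
        mul_assoc, ← h, mul_assoc])

lemma lift_ofPoly {B : Type*} [Ring B] (f : K[X] →+* B) (s : B)
    (h : ∀ p, s * f p = f (tau k K p) * s) (p : K[X]) : lift f s h (ofPoly k K p) = f p := by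
  let := tauAction k K
  refine (SkewMonoidAlgebra.liftNC_single (f : K[X] →+ B) (powersHom B s) _ _).trans ?_
  simp

lemma lift_sigma {B : Type*} [Ring B] (f : K[X] →+* B) (s : B)
    (h : ∀ p, s * f p = f (tau k K p) * s) : lift f s h (sigma k K) = s := by
  let := tauAction k K
  refine (SkewMonoidAlgebra.liftNC_single (f : K[X] →+ B) (powersHom B s) _ _).trans ?_
  simp

lemma ofPoly_mul_sigma_pow (p : K[X]) (n : ℕ) :
    ofPoly k K p * sigma k K ^ n = (SkewPolynomial.monomial n p : SkewPolynomial K[X]) := by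
  let := tauAction k K
  have h : SkewPolynomial.C p * SkewPolynomial.X ^ n = SkewPolynomial.monomial n p := by
    rw [← SkewPolynomial.monomial_one_right_eq_X_pow, SkewPolynomial.C_mul_monomial, mul_one]
  exact h

lemma sigma_mul_ofPoly (p : K[X]) :
    sigma k K * ofPoly k K p = ofPoly k K (tau k K p) * sigma k K := by
  let := tauAction k K
  have h : SkewPolynomial.X * SkewPolynomial.C p =
      SkewPolynomial.C (tau k K p) * SkewPolynomial.X := by
    rw [SkewPolynomial.X, SkewPolynomial.monomial_mul_C, SkewPolynomial.C_mul_monomial]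
    simp only [one_mul, mul_one, Function.iterate_one]
    congr 1
  exact h

@[elab_as_elim]
lemma induction {P : SkewRing k K → Prop} (h0 : P 0) (hadd : ∀ a b, P a → P b → P (a + b))
    (hm : ∀ p n, P (ofPoly k K p * sigma k K ^ n)) (a : SkewRing k K) : P a := by
  refine SkewPolynomial.induction (R := K[X]) (motive := P) a h0 fun n r q _ _ hq => ?_
  refine hadd _ _ ?_ hq
  rw [← ofPoly_mul_sigma_pow]
  exact hm r n

lemma tau_map (p : k[X]) : tau k K (p.map (algebraMap k K)) = p.map (algebraMap k K) := by
  rw [tau, Polynomial.coe_mapRingHom, Polynomial.map_map]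
  congr 1
  ext c
  simp

/-- `K[t,σ]` is a `k[t]`-algebra: `k[t]` is central in it. -/
instance : Algebra k[X] (SkewRing k K) :=
  RingHom.toAlgebra' ((ofPoly k K).comp (Polynomial.mapRingHom (algebraMap k K))) (by
    intro p a
    rw [RingHom.comp_apply, Polynomial.coe_mapRingHom]
    induction a using SkewRing.induction with
    | h0 => simp
    | hadd a b ha hb => rw [mul_add, add_mul, ha, hb]
    | hm r n =>
      have key : Commute (ofPoly k K (p.map (algebraMap k K))) (sigma k K) := by
        have := sigma_mul_ofPoly (k := k) (p.map (algebraMap k K))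
        rw [tau_map] at this
        exact this.symm
      have h2 : Commute (ofPoly k K (p.map (algebraMap k K))) (ofPoly k K r) :=
        (Commute.all _ _).map (ofPoly k K)
      exact (h2.mul_right (key.pow_right n)).eq)

/-- The category of left `K[t,σ]`-modules is `k[t]`-linear. -/
instance : Linear k[X] (ModuleCat.{u} (SkewRing k K)) :=
  letI (M : ModuleCat.{u} (SkewRing k K)) : Module k[X] M :=
    Module.restrictScalars k[X] (SkewRing k K) M
  haveI (M : ModuleCat.{u} (SkewRing k K)) : IsScalarTower k[X] (SkewRing k K) M :=
    IsScalarTower.restrictScalars k[X] (SkewRing k K) M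
  { homModule := fun _ _ => inferInstance }

end SkewRing

/-- A `σ`-module over `K[t]`: a `K[t]`-module `M` with a `τ`-semilinear map `σ : M → M`
(equivalently, a `K[t]`-linear map `τ^* M → M`). -/
structure SigmaModule where
  carrier : Type u
  [addCommGroup : AddCommGroup carrier]
  [module : Module K[X] carrier]
  sigma : carrier →ₛₗ[tau k K] carrier

attribute [instance] SigmaModule.addCommGroup SigmaModule.module

namespace SigmaModule

variable {k K}

/-- The map `σ` of a `σ`-module as an additive endomorphism. -/
def sigmaEnd (M : SigmaModule k K) : AddMonoid.End M.carrier := M.sigma.toAddMonoidHom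

/-- The action of `K[t,σ]` on a `σ`-module. -/
def action (M : SigmaModule k K) : SkewRing k K →+* AddMonoid.End M.carrier :=
  SkewRing.lift (Module.toAddMonoidEnd K[X] M.carrier) M.sigmaEnd (by
    intro p
    ext m
    exact M.sigma.map_smulₛₗ p m)

/-- A `σ`-module is a left `K[t,σ]`-module. -/
instance (M : SigmaModule k K) : Module (SkewRing k K) M.carrier :=
  Module.compHom M.carrier M.action

/-- The left `K[t,σ]`-module given by a `σ`-module. -/
abbrev toModuleCat (M : SigmaModule k K) : ModuleCat.{u} (SkewRing k K) :=
  ModuleCat.of (SkewRing k K) M.carrier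

lemma ofPoly_smul (M : SigmaModule k K) (p : K[X]) (m : M.carrier) :
    SkewRing.ofPoly k K p • m = p • m := by
  change M.action (SkewRing.ofPoly k K p) m = _
  rw [action, SkewRing.lift_ofPoly]
  rfl

lemma sigma_smul (M : SigmaModule k K) (m : M.carrier) :
    SkewRing.sigma k K • m = M.sigma m := by
  change M.action (SkewRing.sigma k K) m = _
  rw [action, SkewRing.lift_sigma]
  rfl

/-- A morphism of `σ`-modules gives a morphism of `K[t,σ]`-modules. -/
def homOfLinear {M N : SigmaModule k K} (f : M.carrier →ₗ[K[X]] N.carrier)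
    (hf : ∀ m, f (M.sigma m) = N.sigma (f m)) : M.toModuleCat ⟶ N.toModuleCat :=
  ModuleCat.ofHom
    { toFun := f
      map_add' := f.map_add
      map_smul' := by
        intro a
        rw [RingHom.id_apply]
        induction a using SkewRing.induction with
        | h0 => intro m; simp
        | hadd a b ha hb => intro m; rw [add_smul, map_add, ha, hb, add_smul]
        | hm p n =>
          have hs : ∀ m, f (SkewRing.sigma k K ^ n • m) = SkewRing.sigma k K ^ n • f m := by
            induction n with
            | zero => simp
            | succ n ih =>
              intro m
              rw [pow_succ, mul_smul, ih, mul_smul, sigma_smul, hf, sigma_smul]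
          intro m
          rw [mul_smul, ofPoly_smul, map_smul, hs, mul_smul, ofPoly_smul] }

variable (k K) in
/-- The unit `σ`-module `K[t]`, with `σ = τ`. -/
abbrev unit : SigmaModule k K where
  carrier := K[X]
  sigma := { tau k K with map_smul' := fun p m => map_mul (tau k K) p m }

end SigmaModule

end Ring

lemma aeval_semilinear {K V W : Type*} [CommRing K] [AddCommGroup V] [Module K V] [AddCommGroup W]
    [Module K W] (φ : K →+* K) (g : V →+ W) (hg : ∀ (c : K) v, g (c • v) = φ c • g v)
    (a : Module.End K V) (b : Module.End K W) (ht : ∀ v, g (a v) = b (g v)) (p : K[X]) (v : V) :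
    g (aeval a p v) = aeval b (p.map φ) (g v) := by
  induction p using Polynomial.induction_on' with
  | add p q hp hq =>
    rw [map_add, LinearMap.add_apply, map_add, hp, hq, Polynomial.map_add, map_add,
      LinearMap.add_apply]
  | monomial n c =>
    have hpow : ∀ v, g ((a ^ n) v) = (b ^ n) (g v) := by
      induction n with
      | zero => simp
      | succ n ih =>
        intro v
        rw [pow_succ, Module.End.mul_apply, ih, ht, pow_succ, Module.End.mul_apply]
    rw [Polynomial.map_monomial, Polynomial.aeval_monomial, Polynomial.aeval_monomial,
      Module.End.mul_apply, Module.End.mul_apply, Module.algebraMap_end_apply,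
      Module.algebraMap_end_apply, hg, hpow]

/-! ### Module schemes -/

/-- An `A`-module scheme over `S`: an `S`-scheme `X` with an `A`-module structure on the sets
`X(T)` of `T`-valued points, for all `S`-schemes `T`, functorially in `T`. -/
structure ModuleScheme (A : Type u) [CommRing A] (S : Scheme.{u}) where
  toOver : Over S
  [addCommGroup : ∀ T : Over S, AddCommGroup (T ⟶ toOver)]
  [module : ∀ T : Over S, Module A (T ⟶ toOver)]
  comp_add : ∀ {T' T : Over S} (f : T' ⟶ T) (x y : T ⟶ toOver), f ≫ (x + y) = f ≫ x + f ≫ y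
  comp_smul : ∀ {T' T : Over S} (f : T' ⟶ T) (a : A) (x : T ⟶ toOver),
    f ≫ (a • x) = a • (f ≫ x)

namespace ModuleScheme

attribute [instance] ModuleScheme.addCommGroup ModuleScheme.module

section General

variable {A : Type u} [CommRing A] {S : Scheme.{u}}

/-- Morphisms of `A`-module schemes. -/
structure Hom (E F : ModuleScheme A S) where
  hom : E.toOver ⟶ F.toOver
  add_comp : ∀ {T : Over S} (x y : T ⟶ E.toOver), (x + y) ≫ hom = x ≫ hom + y ≫ hom
  smul_comp : ∀ {T : Over S} (a : A) (x : T ⟶ E.toOver), (a • x) ≫ hom = a • (x ≫ hom)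

/-- The restriction map `E(T) → E(T')` for a morphism `T' ⟶ T`. -/
def res (E : ModuleScheme A S) {T' T : Over S} (f : T' ⟶ T) : (T ⟶ E.toOver) →ₗ[A] (T' ⟶ E.toOver) where
  toFun x := f ≫ x
  map_add' := E.comp_add f
  map_smul' := E.comp_smul f

/-- The identification of the `T`-valued points of the fibre product `X ×_S S'` with the points of
`X` with values in `T` viewed as an `S`-scheme. -/
def pointsEquiv {S' : Scheme.{u}} (g : S' ⟶ S) (X : Over S) (T : Over S') :
    (T ⟶ (Over.pullback g).obj X) ≃ ((Over.map g).obj T ⟶ X) :=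
  ((Over.mapPullbackAdj g).homEquiv T X).symm

lemma pointsEquiv_comp {S' : Scheme.{u}} (g : S' ⟶ S) (X : Over S) {T' T : Over S'} (f : T' ⟶ T)
    (x : T ⟶ (Over.pullback g).obj X) :
    pointsEquiv g X T' (f ≫ x) = (Over.map g).map f ≫ pointsEquiv g X T x :=
  Adjunction.homEquiv_naturality_left_symm _ _ _

/-- Base change of a module scheme along `g : S' ⟶ S`. -/
def baseChange (E : ModuleScheme A S) {S' : Scheme.{u}} (g : S' ⟶ S) : ModuleScheme A S' where
  toOver := (Over.pullback g).obj E.toOver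
  addCommGroup T := (pointsEquiv g E.toOver T).addCommGroup
  module T := letI := (pointsEquiv g E.toOver T).addCommGroup; (pointsEquiv g E.toOver T).module A
  comp_add {T' T} f x y := by
    let := (pointsEquiv g E.toOver T).addCommGroup
    let := (pointsEquiv g E.toOver T').addCommGroup
    apply (pointsEquiv g E.toOver T').injective
    rw [pointsEquiv_comp, Equiv.add_def, Equiv.add_def, Equiv.apply_symm_apply,
      Equiv.apply_symm_apply, pointsEquiv_comp, pointsEquiv_comp, E.comp_add]
  comp_smul {T' T} f a x := by
    let := (pointsEquiv g E.toOver T).addCommGroup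
    let := (pointsEquiv g E.toOver T').addCommGroup
    let := (pointsEquiv g E.toOver T).module A
    let := (pointsEquiv g E.toOver T').module A
    apply (pointsEquiv g E.toOver T').injective
    rw [pointsEquiv_comp, Equiv.smul_def, Equiv.smul_def, Equiv.apply_symm_apply,
      Equiv.apply_symm_apply, pointsEquiv_comp, E.comp_smul]

lemma pointsEquiv_add (E : ModuleScheme A S) {S' : Scheme.{u}} (g : S' ⟶ S) {T : Over S'}
    (x y : T ⟶ (E.baseChange g).toOver) :
    pointsEquiv g E.toOver T (x + y) = pointsEquiv g E.toOver T x + pointsEquiv g E.toOver T y :=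
  (pointsEquiv g E.toOver T).apply_symm_apply _

lemma pointsEquiv_smul (E : ModuleScheme A S) {S' : Scheme.{u}} (g : S' ⟶ S) {T : Over S'}
    (a : A) (x : T ⟶ (E.baseChange g).toOver) :
    pointsEquiv g E.toOver T (a • x) = a • pointsEquiv g E.toOver T x :=
  (pointsEquiv g E.toOver T).apply_symm_apply _

lemma comp_smul_id (E : ModuleScheme A S) (a : A) {T : Over S} (x : T ⟶ E.toOver) :
    x ≫ (a • 𝟙 E.toOver) = a • x := by
  rw [E.comp_smul, Category.comp_id]

lemma smul_swap (E : ModuleScheme A S) (a b : A) {T : Over S} (x : T ⟶ E.toOver) :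
    a • b • x = b • a • x := by
  rw [smul_smul, mul_comm, ← smul_smul]

end General

section OverField

/-- The affine `K`-scheme `Spec R`. -/
def specOver (K R : Type u) [CommRing K] [CommRing R] [Algebra K R] :
    Over (Spec (CommRingCat.of K)) :=
  Over.mk (Spec.map (CommRingCat.ofHom (algebraMap K R)))

/-- The morphism of affine `K`-schemes given by a homomorphism of `K`-algebras. -/
def specOverMap {K R R' : Type u} [CommRing K] [CommRing R] [Algebra K R] [CommRing R']
    [Algebra K R'] (f : R →ₐ[K] R') : specOver K R' ⟶ specOver K R :=
  Over.homMk (Spec.map (CommRingCat.ofHom (f : R →+* R'))) (by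
    change Spec.map _ ≫ Spec.map _ = Spec.map _
    rw [← Spec.map_comp, ← CommRingCat.ofHom_comp, AlgHom.comp_algebraMap])

/-- The ring homomorphism `K → Γ(T, 𝒪)` for a `K`-scheme `T`. -/
def scalar {K : Type u} [CommRing K] (T : Over (Spec (CommRingCat.of K))) :
    K →+* Γ(T.left, ⊤) :=
  ((Scheme.ΓSpecIso (CommRingCat.of K)).inv ≫ T.hom.appTop).hom

/-- The pull-back of a global function on `X` to `T` along `x : T ⟶ X`. -/
def pull {S : Scheme.{u}} {T X : Over S} (x : T ⟶ X) : Γ(X.left, ⊤) →+* Γ(T.left, ⊤) :=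
  x.left.appTop.hom

lemma pull_comp {S : Scheme.{u}} {T T' X : Over S} (f : T' ⟶ T) (x : T ⟶ X)
    (h : Γ(X.left, ⊤)) : pull (f ≫ x) h = pull f (pull x h) := by
  change ((f ≫ x).left.appTop).hom h = _
  rw [Over.comp_left, Scheme.Hom.comp_appTop]
  rfl

lemma pull_scalar {K : Type u} [CommRing K] {T X : Over (Spec (CommRingCat.of K))} (x : T ⟶ X)
    (c : K) : pull x (scalar X c) = scalar T c := by
  have h : scalar T = (pull x).comp (scalar X) := by
    rw [pull, scalar, scalar, ← CommRingCat.hom_comp, Category.assoc, ← Scheme.Hom.comp_appTop,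
      Over.w]
  rw [h, RingHom.comp_apply]

/-- The morphism of spectra given by an extension of fields. -/
abbrev specMap (K K' : Type u) [CommRing K] [CommRing K'] [Algebra K K'] :
    Spec (CommRingCat.of K') ⟶ Spec (CommRingCat.of K) :=
  Spec.map (CommRingCat.ofHom (algebraMap K K'))

lemma scalar_map {K K' : Type u} [CommRing K] [CommRing K'] [Algebra K K']
    (T : Over (Spec (CommRingCat.of K'))) (c : K) :
    scalar ((Over.map (specMap K K')).obj T) c = scalar T (algebraMap K K' c) := by
  have h : scalar ((Over.map (specMap K K')).obj T) = (scalar T).comp (algebraMap K K') := by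
    change ((Scheme.ΓSpecIso (CommRingCat.of K)).inv ≫ (T.hom ≫ specMap K K').appTop).hom = _
    rw [Scheme.Hom.comp_appTop, ← Category.assoc, ← Scheme.ΓSpecIso_inv_naturality]
    rfl
  rw [h, RingHom.comp_apply]

variable {k K : Type u} [Field k] [Field K] [Algebra k K]

/-- The `k[t]`-module `E(R)` of `R`-valued points of a `k[t]`-module scheme `E` over `K`. -/
abbrev points (E : ModuleScheme k[X] (Spec (CommRingCat.of K))) (R : Type u) [CommRing R]
    [Algebra K R] : Type u :=
  specOver K R ⟶ E.toOver

/-- A global function `f` on `E`, seen as a morphism from `E` to the affine line, is a homomorphism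
of `k`-vector space schemes from `E` to the additive group `𝔾ₐ`. -/
def IsGaHom (E : ModuleScheme k[X] (Spec (CommRingCat.of K))) (f : Γ(E.toOver.left, ⊤)) : Prop :=
  ∀ (T : Over (Spec (CommRingCat.of K))) (x y : T ⟶ E.toOver),
    pull (x + y) f = pull x f + pull y f ∧
    ∀ c : k, pull ((C c : k[X]) • x) f = scalar T (algebraMap k K c) * pull x f

/-- The group `M_E` of homomorphisms of `k`-vector space schemes `E → 𝔾ₐ` over `K`. -/
def GaHom (E : ModuleScheme k[X] (Spec (CommRingCat.of K))) : AddSubgroup Γ(E.toOver.left, ⊤) where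
  carrier := { f | E.IsGaHom f }
  zero_mem' := fun T x y => by simp
  add_mem' := fun {f g} hf hg T x y => by
    refine ⟨?_, fun c => ?_⟩
    · rw [map_add, map_add, map_add, (hf T x y).1, (hg T x y).1]; ring
    · rw [map_add, map_add, (hf T x y).2, (hg T x y).2]; ring
  neg_mem' := fun {f} hf T x y => by
    refine ⟨?_, fun c => ?_⟩
    · rw [map_neg, map_neg, map_neg, (hf T x y).1]; ring
    · rw [map_neg, map_neg, (hf T x y).2]; ring

variable (E : ModuleScheme k[X] (Spec (CommRingCat.of K)))

/-- `K` acts on `M_E` through its action on `𝔾ₐ`. -/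
instance : Module K E.GaHom where
  smul c f := ⟨scalar E.toOver c * f.1, fun T x y => by
    refine ⟨?_, fun a => ?_⟩
    · simp only [map_mul, pull_scalar, (f.2 T x y).1]; ring
    · simp only [map_mul, pull_scalar, (f.2 T x y).2]; ring⟩
  one_smul f := Subtype.ext (by change scalar E.toOver 1 * f.1 = f.1; simp)
  mul_smul a b f := Subtype.ext (by
    change scalar E.toOver (a * b) * f.1 = scalar E.toOver a * (scalar E.toOver b * f.1)
    rw [map_mul, mul_assoc])
  smul_zero a := Subtype.ext (by change scalar E.toOver a * 0 = 0; simp)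
  smul_add a f g := Subtype.ext (by
    change scalar E.toOver a * (f.1 + g.1) = scalar E.toOver a * f.1 + scalar E.toOver a * g.1
    ring)
  add_smul a b f := Subtype.ext (by
    change scalar E.toOver (a + b) * f.1 = scalar E.toOver a * f.1 + scalar E.toOver b * f.1
    rw [map_add]; ring)
  zero_smul f := Subtype.ext (by change scalar E.toOver 0 * f.1 = 0; simp)

lemma GaHom.coe_smul (c : K) (f : E.GaHom) :
    ((c • f : E.GaHom) : Γ(E.toOver.left, ⊤)) = scalar E.toOver c * f := rfl

/-- `t` acts on `M_E` by composition with the action of `t` on `E`. -/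
def tEnd : E.GaHom →ₗ[K] E.GaHom where
  toFun f := ⟨pull ((X : k[X]) • 𝟙 E.toOver) f.1, fun T x y => by
    refine ⟨?_, fun c => ?_⟩
    · rw [← pull_comp, ← pull_comp, ← pull_comp, comp_smul_id, comp_smul_id, comp_smul_id,
        smul_add]
      exact (f.2 T _ _).1
    · rw [← pull_comp, ← pull_comp, comp_smul_id, comp_smul_id, smul_swap]
      exact (f.2 T _ ((X : k[X]) • y)).2 c⟩
  map_add' f g := Subtype.ext (map_add (pull ((X : k[X]) • 𝟙 E.toOver)) f.1 g.1)
  map_smul' c f := Subtype.ext (by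
    change pull ((X : k[X]) • 𝟙 E.toOver) (scalar E.toOver c * f.1) = scalar E.toOver c * pull _ f.1
    rw [map_mul, pull_scalar])

/-- `M_E` is a `K[t]`-module. -/
instance : Module K[X] E.GaHom :=
  Module.compHom E.GaHom (aeval E.tEnd : K[X] →ₐ[K] Module.End K E.GaHom).toRingHom

lemma GaHom.poly_smul (p : K[X]) (f : E.GaHom) : p • f = aeval E.tEnd p f := rfl

section Motive

variable [Fintype k]

/-- The `q`-th power map on `M_E`, that is, composition with the `q`-th power Frobenius of `𝔾ₐ`. -/
def frob : E.GaHom →+ E.GaHom where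
  toFun f := ⟨f.1 ^ Fintype.card k, fun T x y => by
    let : Algebra k Γ(T.left, ⊤) := ((scalar T).comp (algebraMap k K)).toAlgebra
    refine ⟨?_, fun c => ?_⟩
    · rw [map_pow, map_pow, map_pow, (f.2 T x y).1]
      exact map_add (FiniteField.frobeniusAlgHom k Γ(T.left, ⊤)) _ _
    · rw [map_pow, map_pow, (f.2 T x y).2, mul_pow, ← map_pow, ← map_pow, FiniteField.pow_card]⟩
  map_zero' := Subtype.ext (zero_pow Fintype.card_ne_zero)
  map_add' f g := by
    let : Algebra k Γ(E.toOver.left, ⊤) := ((scalar E.toOver).comp (algebraMap k K)).toAlgebra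
    exact Subtype.ext (map_add (FiniteField.frobeniusAlgHom k Γ(E.toOver.left, ⊤)) f.1 g.1)

lemma frob_smul (c : K) (f : E.GaHom) : E.frob (c • f) = c ^ Fintype.card k • E.frob f := by
  apply Subtype.ext
  change (scalar E.toOver c * f.1) ^ Fintype.card k = scalar E.toOver (c ^ Fintype.card k) * _
  rw [mul_pow, map_pow]
  rfl

lemma frob_tEnd (f : E.GaHom) : E.frob (E.tEnd f) = E.tEnd (E.frob f) :=
  Subtype.ext (map_pow (pull ((X : k[X]) • 𝟙 E.toOver)) f.1 _).symm

lemma frob_poly_smul (p : K[X]) (f : E.GaHom) : E.frob (p • f) = tau k K p • E.frob f := by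
  exact aeval_semilinear _ E.frob E.frob_smul E.tEnd E.tEnd E.frob_tEnd p f

/-- The `σ`-module `M_E = Hom(E, 𝔾ₐ)` over `K[t]`. -/
abbrev sigmaModule : SigmaModule k K where
  carrier := E.GaHom
  sigma := { E.frob with map_smul' := E.frob_poly_smul }

/-- `M_E` as a left `K[t,σ]`-module. -/
abbrev motive : ModuleCat.{u} (SkewRing k K) := E.sigmaModule.toModuleCat

variable {E} in
/-- The `K[t]`-linear map `M_F → M_E` given by a morphism `E → F`. -/
def gaHomMap {F : ModuleScheme k[X] (Spec (CommRingCat.of K))} (φ : E.Hom F) :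
    F.GaHom →ₗ[K[X]] E.GaHom :=
  let g : F.GaHom →+ E.GaHom :=
    { toFun := fun f => ⟨pull φ.hom f.1, fun T x y => by
        refine ⟨?_, fun c => ?_⟩
        · rw [← pull_comp, ← pull_comp, ← pull_comp, φ.add_comp]
          exact (f.2 T _ _).1
        · rw [← pull_comp, ← pull_comp, φ.smul_comp]
          exact (f.2 T _ (y ≫ φ.hom)).2 c⟩
      map_zero' := Subtype.ext (map_zero (pull φ.hom))
      map_add' := fun f g => Subtype.ext (map_add (pull φ.hom) f.1 g.1) }
  { g with
    map_smul' := fun p f => by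
      have h := aeval_semilinear (RingHom.id K) g (fun c f => Subtype.ext (by
        change pull φ.hom (scalar F.toOver c * f.1) = scalar E.toOver c * pull φ.hom f.1
        rw [map_mul, pull_scalar])) F.tEnd E.tEnd (fun f => Subtype.ext (by
          change pull φ.hom (pull ((X : k[X]) • 𝟙 F.toOver) f.1) =
            pull ((X : k[X]) • 𝟙 E.toOver) (pull φ.hom f.1)
          rw [← pull_comp, ← pull_comp, comp_smul_id, φ.smul_comp, Category.id_comp])) p f
      rw [Polynomial.map_id] at h
      exact h }

variable {E} in
/-- The `K[t,σ]`-linear map `M_F → M_E` given by a morphism `E → F`. -/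
def motiveMap {F : ModuleScheme k[X] (Spec (CommRingCat.of K))} (φ : E.Hom F) :
    F.motive ⟶ E.motive :=
  SigmaModule.homOfLinear (M := F.sigmaModule) (N := E.sigmaModule) (gaHomMap φ)
    (fun f => Subtype.ext (map_pow (pull φ.hom) f.1 _))

end Motive

/-! ### The Lie algebra -/

/-- The tangent space at zero: the kernel of `E(K[ε]) → E(K)`, `ε ↦ 0`. -/
def Lie : Submodule k[X] (E.points (DualNumber K)) :=
  LinearMap.ker (E.res (specOverMap (TrivSqZeroExt.fstHom K K K)))

/-- The endomorphism `ε ↦ c ε` of the `K`-algebra `K[ε]`. -/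
def epsScale (c : K) : DualNumber K →ₐ[K] DualNumber K :=
  TrivSqZeroExt.map (LinearMap.lsmul K K c)

/-- Multiplication by `c ∈ K` on `Lie(E)`: the map induced by `ε ↦ c ε`. -/
def lieScale (c : K) : E.Lie →ₗ[k[X]] E.Lie :=
  (E.res (specOverMap (epsScale c))).restrict (by
    intro x hx
    rw [Lie, LinearMap.mem_ker] at hx ⊢
    refine Eq.trans ?_ hx
    change specOverMap _ ≫ specOverMap _ ≫ x = specOverMap _ ≫ x
    rw [← Category.assoc]
    congr 1
    apply Over.OverMorphism.ext
    change Spec.map _ ≫ Spec.map _ = Spec.map _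
    rw [← Spec.map_comp, ← CommRingCat.ofHom_comp, epsScale, ← AlgHom.comp_toRingHom,
      TrivSqZeroExt.fstHom_comp_map])

/-! ### Abelian `t`-modules -/

/-- The `k`-vector space scheme underlying `E` is isomorphic to `𝔾ₐ^d`, the scheme with points
`T ↦ Γ(T, 𝒪)^d` (isomorphisms are given on points). -/
def IsoGaPow (d : ℕ) : Prop :=
  ∃ e : ∀ T : Over (Spec (CommRingCat.of K)), (T ⟶ E.toOver) ≃+ (Fin d → Γ(T.left, ⊤)),
    (∀ (T' T : Over (Spec (CommRingCat.of K))) (f : T' ⟶ T) (x : T ⟶ E.toOver) (i : Fin d),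
      e T' (f ≫ x) i = pull f (e T x i)) ∧
    ∀ (T : Over (Spec (CommRingCat.of K))) (c : k) (x : T ⟶ E.toOver) (i : Fin d),
      e T ((C c : k[X]) • x) i = scalar T (algebraMap k K c) * e T x i

/-- `E` is an abelian `t`-module over `K`, relative to `θ ∈ K`, the image of `t` under the structure
homomorphism `k[t] → K`. -/
structure IsAbelian (θ : K) : Prop where
  iso_gaPow : ∃ d : ℕ, (E.baseChange (specMap K (AlgebraicClosure K))).IsoGaPow d
  nilpotent : IsNilpotent (algebraMap k[X] (Module.End k[X] E.Lie) X - E.lieScale θ)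
  finite : Module.Finite K[X] E.GaHom

end OverField

section FieldExtension

variable {k K : Type u} [Field k] [Field K] [Algebra k K]
  (E : ModuleScheme k[X] (Spec (CommRingCat.of K)))
  (K' : Type u) [Field K'] [Algebra k K'] [Algebra K K'] [IsScalarTower k K K']

/-- The map `E(K) → E_{K'}(K')` for a field extension `K'` of `K`. -/
def pointsBaseChange (x : E.points K) : (E.baseChange (specMap K K')).points K' :=
  (pointsEquiv (specMap K K') E.toOver (specOver K' K')).symm
    (Over.homMk (V := specOver K K) (specMap K K') (by
      change Spec.map _ ≫ Spec.map _ = Spec.map _ ≫ Spec.map _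
      rw [← Spec.map_comp, ← Spec.map_comp]
      rfl) ≫ x)

/-- The projection `E_{K'} → E`. -/
def proj : (Over.map (specMap K K')).obj (E.baseChange (specMap K K')).toOver ⟶ E.toOver :=
  (Over.mapPullbackAdj (specMap K K')).counit.app E.toOver

/-- The map `M_E → M_{E_{K'}}` for a field extension `K'` of `K`. -/
def gaHomBaseChange (f : E.GaHom) : (E.baseChange (specMap K K')).GaHom :=
  ⟨pull (E.proj K') f.1, fun T x y => by
    have h : ∀ x : T ⟶ (E.baseChange (specMap K K')).toOver,
        pull x (pull (E.proj K') f.1) = pull (pointsEquiv (specMap K K') E.toOver T x) f.1 := by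
      intro x
      have : pointsEquiv (specMap K K') E.toOver T x = (Over.map (specMap K K')).map x ≫ E.proj K' :=
        Adjunction.homEquiv_counit (adj := Over.mapPullbackAdj (specMap K K')) _ _ _
      rw [this, pull_comp]
      rfl
    refine ⟨?_, fun c => ?_⟩
    · rw [h, h, h, pointsEquiv_add]
      exact (f.2 _ _ _).1
    · rw [h, h, pointsEquiv_smul, (f.2 _ _ (pointsEquiv (specMap K K') E.toOver T y)).2, scalar_map,
        ← IsScalarTower.algebraMap_apply]⟩

end FieldExtension

/-! ### Extensions of `M_E` by `K[t]` -/

section Extensions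

variable {k K : Type u} [Field k] [Fintype k] [Field K] [Algebra k K]

/-- The `k[t]`-module `Ext¹(M_E, K[t])` in the category of left `K[t,σ]`-modules. -/
abbrev Ext1 (E : ModuleScheme k[X] (Spec (CommRingCat.of K))) : Type u :=
  Abelian.Ext.{u} E.motive (SigmaModule.unit k K).toModuleCat 1

/-- The map `Ext¹(M_E, K[t]) → Ext¹(M_F, K[t])` given by a morphism `E → F`: the pull-back of
extensions along `M_F → M_E`. -/
def ext1Map {E F : ModuleScheme k[X] (Spec (CommRingCat.of K))} (φ : E.Hom F) (x : E.Ext1) :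
    F.Ext1 :=
  (Abelian.Ext.mk₀ (motiveMap φ)).comp x (zero_add 1)

/-- An extension `0 → K[t] → M → M_E → 0` of left `K[t,σ]`-modules. -/
structure Extension (E : ModuleScheme k[X] (Spec (CommRingCat.of K))) where
  M : ModuleCat.{u} (SkewRing k K)
  i : (SigmaModule.unit k K).toModuleCat ⟶ M
  π : M ⟶ E.motive
  zero : i ≫ π = 0
  exact : (ShortComplex.mk i π zero).ShortExact

/-- The class of an extension in `Ext¹(M_E, K[t])`. -/
def Extension.extClass {E : ModuleScheme k[X] (Spec (CommRingCat.of K))} (S : Extension E) :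
    E.Ext1 :=
  S.exact.extClass

/-- The extension `S'` is the base change of `S` to the field `K'`, that is, there is a map from the
middle term of `S` to that of `S'` which is semilinear with respect to `K[t,σ] → K'[t,σ]` and
compatible with `K[t] → K'[t]` and `M_E → M_{E_{K'}}`. -/
def Extension.IsBaseChange {E : ModuleScheme k[X] (Spec (CommRingCat.of K))} (S : Extension E)
    {K' : Type u} [Field K'] [Algebra k K'] [Algebra K K'] [IsScalarTower k K K']
    (S' : Extension (E.baseChange (specMap K K'))) : Prop :=
  ∃ g : S.M →+ S'.M,
    (∀ (p : K[X]) (m : S.M), g (SkewRing.ofPoly k K p • m) =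
      SkewRing.ofPoly k K' (p.map (algebraMap K K')) • g m) ∧
    (∀ m : S.M, g (SkewRing.sigma k K • m) = SkewRing.sigma k K' • g m) ∧
    (∀ p : K[X], g (S.i.hom p) = S'.i.hom (p.map (algebraMap K K'))) ∧
    ∀ m : S.M, S'.π.hom (g m) = E.gaHomBaseChange K' (S.π.hom m)

end Extensions

end ModuleScheme

end

end TMotif

/-! Write `M` for `M_E`, and let `P` be the group of `K`-linear maps `x : M → K` with `x (σ m) = x m
^ q`, that is `Hom_{K[σ]}(M, K)`. The isomorphism is the composite of `E(K) ≅ P` and `P ≅ Ext¹(M,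
K[t])`.

The second map comes from the sequence `0 → M[T] → M[T] → M → 0`, with first map `T - t`, of modules
induced from `K[σ]` (`polyComplex_shortExact`). Maps of `K[t,σ]`-modules out of `M[T]` are
`K[σ]`-linear maps out of `M`, so a functional `x` gives a map `M[T] → K[t]`, and pushing out along
it gives a class in `Ext¹` (`functionalExt`). An extension has this class as soon as it has a
`K[σ]`-linear section `s` with `t s - s t = x`, where `x` takes values in the constants `K ⊂ K[t]`
(`functionalExt_eq_extClass`).

Such a section always exists (`SigmaModule.exists_section`). A `K`-linear section fails to commute
with `σ` by some `δ : M → K[t]` and with `t` by some `ε : M → K[t]`. Over the algebraic closure `L`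
the defect `δ` is a coboundary, because `L ⊗ M` is free over `L[σ]` (`coboundarySurjective`), and
division by `T - t` makes the `t`-defect constant (`exists_division`). The resulting correction `M →
L[t]` already takes values in `K[t]`: as `M` is finitely generated over `K[σ]`, its coefficients of
large degree lie in `K`, and the `t`-defect carries this down one degree at a time
(`coeff_mem_of_equivariant`). The same argument with `0` in place of `K` (`eq_zero_of_equivariant`)
gives the injectivity and the compatibility with field extensions.

For `E(K) ≅ P`, the functions on `E_L` form a polynomial ring, and the additive ones have as basis
the `q ^ n`-th powers of the coordinates (`mem_span_of_additive`, `IsCoordinates.exists_basis`).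
This gives the freeness over `L[σ]`. To return to `K`: `E` is affine by descent
(`isAffine_of_isPullback`), `M` spans the additive functions on `E_L` (`mem_span_gaHomBaseChange`),
and `M` generates the functions on `E` as an algebra (`IsCoordinates.function_induction`). Hence
points are determined by their values on `M`, and a functional `M → K` extends to an `L`-point which
takes values in `K` on functions of `E`, that is, to a `K`-point
(`IsCoordinates.evalPoint_surjective`). -/

namespace TMotif

noncomputable section

/-! ### The induced module `M[T]` and the resolution of `M` by it. -/

section SkewModules

variable {k K : Type u} [Field k] [Fintype k] [Field K] [Algebra k K]

/-- An additive map which is compatible with `K[t]` and `σ` is `K[t,σ]`-linear. -/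
def homOfEquivariant {M N : ModuleCat.{u} (SkewRing k K)} (f : M →+ N)
    (hp : ∀ (p : K[X]) (m : M), f (SkewRing.ofPoly k K p • m) = SkewRing.ofPoly k K p • f m)
    (hs : ∀ m : M, f (SkewRing.sigma k K • m) = SkewRing.sigma k K • f m) : M ⟶ N :=
  ModuleCat.ofHom
    { toFun := f
      map_add' := f.map_add
      map_smul' := by
        intro a
        rw [RingHom.id_apply]
        induction a using SkewRing.induction with
        | h0 => intro m; simp
        | hadd a b ha hb => intro m; rw [add_smul, map_add, ha, hb, add_smul]
        | hm p n =>
          have hs' : ∀ m, f (SkewRing.sigma k K ^ n • m) = SkewRing.sigma k K ^ n • f m := by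
            induction n with
            | zero => simp
            | succ n ih =>
              intro m
              rw [pow_succ, mul_smul, ih, mul_smul, hs]
          intro m
          rw [mul_smul, hp, hs', mul_smul] }

lemma tau_C (c : K) : tau k K (C c) = C (c ^ Fintype.card k) := by
  simp [tau]

lemma tau_X : tau k K X = X := by
  simp [tau]

lemma coeff_tau (p : K[X]) (n : ℕ) : (tau k K p).coeff n = p.coeff n ^ Fintype.card k := by
  simp [tau]

namespace SigmaModule

/-- The `K`-vector space underlying a `σ`-module. -/
@[reducible] def scalarModule (M : SigmaModule k K) : Module K M.carrier :=
  Module.compHom M.carrier (C : K →+* K[X])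

attribute [local instance] scalarModule

lemma scalar_smul_def (M : SigmaModule k K) (c : K) (m : M.carrier) : c • m = (C c : K[X]) • m :=
  rfl

/-- The `σ`-module `M[T] = K[T] ⊗_K M`. -/
def poly (M : SigmaModule k K) : SigmaModule k K where
  -- The variable of `K[t]` acts here as `T`; the original `t` of `M` survives only as an
  -- endomorphism of the coefficients.
  carrier := PolynomialModule K M.carrier
  sigma :=
    { toFun := fun f => .ofCoeff K (f.coeff.mapRange M.sigma M.sigma.map_zero)
      map_add' := fun f g => by
        apply PolynomialModule.coeff_injective
        ext n
        simp
      map_smul' := fun p f => by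
        apply PolynomialModule.coeff_injective
        ext n
        simp [PolynomialModule.smul_apply, scalar_smul_def, coeff_tau, tau_C] }

variable {M : SigmaModule k K}

/-- The element `m Tⁿ` of `M[T]`. -/
def polySingle (M : SigmaModule k K) (n : ℕ) : M.carrier →+ M.poly.carrier where
  toFun m := PolynomialModule.single K n m
  map_zero' := PolynomialModule.single_zero _
  map_add' := PolynomialModule.single_add n

/-- The coefficients of an element of `M[T]`. -/
def polyCoeff (M : SigmaModule k K) : M.poly.carrier →+ (ℕ →₀ M.carrier) :=
  (PolynomialModule.coeffAddEquiv (R := K) (M := M.carrier)).toAddMonoidHom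

lemma polyCoeff_injective : Function.Injective M.polyCoeff :=
  (PolynomialModule.coeffAddEquiv (R := K) (M := M.carrier)).injective

lemma polyCoeff_single (n : ℕ) (m : M.carrier) :
    M.polyCoeff (M.polySingle n m) = Finsupp.single n m := rfl

lemma poly_induction {P : M.poly.carrier → Prop} (f : M.poly.carrier) (zero : P 0)
    (add : ∀ f g, P f → P g → P (f + g)) (single : ∀ n m, P (M.polySingle n m)) : P f :=
  PolynomialModule.induction_linear (p := P) f zero add single

lemma C_smul_polySingle (c : K) (n : ℕ) (m : M.carrier) :
    (C c : K[X]) • M.polySingle n m = M.polySingle n ((C c : K[X]) • m) := by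
  have := PolynomialModule.monomial_smul_single 0 c n m
  rw [zero_add] at this
  exact this

lemma X_smul_polySingle (n : ℕ) (m : M.carrier) :
    (X : K[X]) • M.polySingle n m = M.polySingle (n + 1) m := by
  have := PolynomialModule.monomial_smul_single 1 (1 : K) n m
  rw [one_smul, add_comm] at this
  exact this

lemma sigma_polySingle (n : ℕ) (m : M.carrier) :
    M.poly.sigma (M.polySingle n m) = M.polySingle n (M.sigma m) := by
  apply polyCoeff_injective
  exact Finsupp.mapRange_single (f := M.sigma) (hf := M.sigma.map_zero)

/-- A `K`-linear `σ`-equivariant additive map from a `σ`-module to a `K[t,σ]`-module. -/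
structure IsScalarEquivariant {M : SigmaModule k K} {N : ModuleCat.{u} (SkewRing k K)}
    (g : M.carrier →+ N) : Prop where
  smul : ∀ (c : K) m, g ((C c : K[X]) • m) = SkewRing.ofPoly k K (C c) • g m
  sigma : ∀ m, g (M.sigma m) = SkewRing.sigma k K • g m

/-- The additive extension `M[T] → N` of `g : M → N`. -/
def polyLiftAdd {N : ModuleCat.{u} (SkewRing k K)} (g : M.carrier →+ N) :
    M.poly.carrier →+ N :=
  (Finsupp.liftAddHom fun n =>
    (DistribSMul.toAddMonoidHom N (SkewRing.ofPoly k K (X ^ n))).comp g).comp M.polyCoeff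

lemma polyLiftAdd_single {N : ModuleCat.{u} (SkewRing k K)} (g : M.carrier →+ N) (n : ℕ)
    (m : M.carrier) : polyLiftAdd g (M.polySingle n m) = SkewRing.ofPoly k K (X ^ n) • g m := by
  simp [polyLiftAdd, polyCoeff_single]

lemma ofPoly_induction {A B : Type*} [AddCommGroup A] [AddCommGroup B] [Module (SkewRing k K) A]
    [Module (SkewRing k K) B] (f : A →+ B)
    (hC : ∀ (c : K) a, f (SkewRing.ofPoly k K (C c) • a) = SkewRing.ofPoly k K (C c) • f a)
    (hX : ∀ a, f (SkewRing.ofPoly k K X • a) = SkewRing.ofPoly k K X • f a) (p : K[X]) (a : A) :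
    f (SkewRing.ofPoly k K p • a) = SkewRing.ofPoly k K p • f a := by
  induction p using Polynomial.induction_on generalizing a with
  | C c => exact hC c a
  | add p q hp hq => simp only [map_add, add_smul, hp, hq]
  | monomial n c ih => rw [pow_succ, ← mul_assoc, map_mul, mul_smul, mul_smul, ih, hX]

/-- The `K[t,σ]`-linear extension `M[T] → N` of a `K`-linear `σ`-equivariant map `M → N`. -/
def polyLift {N : ModuleCat.{u} (SkewRing k K)} (g : M.carrier →+ N) (hg : IsScalarEquivariant g) :
    M.poly.toModuleCat ⟶ N :=
  homOfEquivariant (M := M.poly.toModuleCat) (polyLiftAdd g)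
    (by
      apply ofPoly_induction
      · intro c f
        rw [ofPoly_smul]
        induction f using poly_induction with
        | zero => rw [smul_zero, map_zero, smul_zero]
        | add f g hf hg => rw [smul_add, map_add, hf, hg, map_add, smul_add]
        | single n m =>
          rw [C_smul_polySingle, polyLiftAdd_single, polyLiftAdd_single, hg.smul, ← mul_smul,
            ← mul_smul, ← map_mul, ← map_mul, mul_comm]
      · intro f
        rw [ofPoly_smul]
        induction f using poly_induction with
        | zero => rw [smul_zero, map_zero, smul_zero]
        | add f g hf hg => rw [smul_add, map_add, hf, hg, map_add, smul_add]
        | single n m =>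
          rw [X_smul_polySingle, polyLiftAdd_single, polyLiftAdd_single, ← mul_smul, ← map_mul,
            pow_succ'])
    (by
      intro f
      rw [sigma_smul]
      induction f using poly_induction with
      | zero => rw [map_zero, map_zero, smul_zero]
      | add f g hf hg => rw [map_add, map_add, hf, hg, map_add, smul_add]
      | single n m =>
        rw [sigma_polySingle, polyLiftAdd_single, polyLiftAdd_single, hg.sigma, ← mul_smul,
          ← mul_smul, SkewRing.sigma_mul_ofPoly, map_pow (tau k K), tau_X])

lemma polyLift_single {N : ModuleCat.{u} (SkewRing k K)} (g : M.carrier →+ N)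
    (hg : IsScalarEquivariant g) (n : ℕ) (m : M.carrier) :
    (polyLift g hg).hom (M.polySingle n m) = SkewRing.ofPoly k K (X ^ n) • g m :=
  polyLiftAdd_single g n m

lemma polyLift_single_zero {N : ModuleCat.{u} (SkewRing k K)} (g : M.carrier →+ N)
    (hg : IsScalarEquivariant g) (m : M.carrier) :
    (polyLift g hg).hom (M.polySingle 0 m) = g m := by
  rw [polyLift_single, pow_zero, map_one, one_smul]

/-- The constants `M ⊂ M[T]` generate `M[T]` over `K[t]`. With `polyLift` this is the adjunction
between restriction to `K[σ]` and induction. -/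
lemma poly_hom_ext {N : ModuleCat.{u} (SkewRing k K)} {f g : M.poly.toModuleCat ⟶ N}
    (h : ∀ m, f.hom (M.polySingle 0 m) = g.hom (M.polySingle 0 m)) : f = g := by
  ext1
  refine LinearMap.ext fun x => ?_
  induction x using poly_induction with
  | zero => rw [map_zero, map_zero]
  | add f g hf hg => rw [map_add, map_add, hf, hg]
  | single n m =>
    have : M.polySingle n m = SkewRing.ofPoly k K (X ^ n) • M.polySingle 0 m := by
      rw [ofPoly_smul]
      induction n with
      | zero => rw [pow_zero, one_smul]
      | succ n ih => rw [pow_succ', mul_smul, ← ih, X_smul_polySingle]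
    rw [this, map_smul, map_smul, h]

/-- The evaluation `M[T] → M`, `T ↦ t`. -/
def polyEval (M : SigmaModule k K) : M.poly.toModuleCat ⟶ M.toModuleCat :=
  polyLift (N := M.toModuleCat) (AddMonoidHom.id _)
    ⟨fun _ _ => (M.ofPoly_smul _ _).symm, fun m => (M.sigma_smul m).symm⟩

lemma polyEval_single (n : ℕ) (m : M.carrier) :
    M.polyEval.hom (M.polySingle n m) = (X ^ n : K[X]) • m :=
  (polyLift_single _ _ n m).trans (M.ofPoly_smul _ _)

lemma polyEval_single_zero (m : M.carrier) : M.polyEval.hom (M.polySingle 0 m) = m :=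
  polyLift_single_zero _ _ m

/-- The map `m ↦ T m - t m` from `M` to `M[T]`. -/
def polyDiffAdd (M : SigmaModule k K) : M.carrier →+ M.poly.toModuleCat :=
  M.polySingle 1 - (M.polySingle 0).comp (DistribSMul.toAddMonoidHom M.carrier (X : K[X]))

lemma polyDiffAdd_apply (m : M.carrier) :
    M.polyDiffAdd m = M.polySingle 1 m - M.polySingle 0 ((X : K[X]) • m) := rfl

lemma isScalarEquivariant_polyDiffAdd : IsScalarEquivariant M.polyDiffAdd where
  smul c m := by
    rw [ofPoly_smul, polyDiffAdd_apply, polyDiffAdd_apply, smul_sub, C_smul_polySingle,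
      C_smul_polySingle, smul_comm]
  sigma m := by
    rw [sigma_smul, polyDiffAdd_apply, polyDiffAdd_apply, map_sub, sigma_polySingle,
      sigma_polySingle, M.sigma.map_smulₛₗ, tau_X]

/-- Multiplication by `T - t` on `M[T]`. -/
def polyDiff (M : SigmaModule k K) : M.poly.toModuleCat ⟶ M.poly.toModuleCat :=
  polyLift M.polyDiffAdd isScalarEquivariant_polyDiffAdd

lemma polyDiff_single (n : ℕ) (m : M.carrier) :
    M.polyDiff.hom (M.polySingle n m) =
      M.polySingle (n + 1) m - M.polySingle n ((X : K[X]) • m) := by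
  have key : ∀ m, (X ^ n : K[X]) • M.polySingle 0 m = M.polySingle n m := by
    intro m
    induction n with
    | zero => rw [pow_zero, one_smul]
    | succ n ih => rw [pow_succ', mul_smul, ih, X_smul_polySingle]
  refine (polyLift_single _ _ n m).trans ?_
  rw [ofPoly_smul, polyDiffAdd_apply, smul_sub, key, ← X_smul_polySingle, smul_smul, ← pow_succ,
    pow_succ', mul_smul, key, X_smul_polySingle]

lemma polyDiff_single_zero (m : M.carrier) :
    M.polyDiff.hom (M.polySingle 0 m) = M.polySingle 1 m - M.polySingle 0 ((X : K[X]) • m) :=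
  polyDiff_single 0 m

lemma polyCoeff_polyDiff (f : M.poly.carrier) (n : ℕ) :
    M.polyCoeff (M.polyDiff.hom f) (n + 1) =
      M.polyCoeff f n - (X : K[X]) • M.polyCoeff f (n + 1) := by
  induction f using poly_induction with
  | zero => simp
  | add f g hf hg =>
    have h1 : M.polyCoeff (M.polyDiff.hom (f + g)) =
        M.polyCoeff (M.polyDiff.hom f) + M.polyCoeff (M.polyDiff.hom g) := by
      rw [← map_add]
      exact congrArg _ (map_add M.polyDiff.hom f g)
    rw [h1, Finsupp.add_apply, hf, hg, map_add M.polyCoeff, Finsupp.add_apply, Finsupp.add_apply, smul_add]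
    abel
  | single j m =>
    rw [polyDiff_single, map_sub, polyCoeff_single, polyCoeff_single, polyCoeff_single]
    simp only [Finsupp.sub_apply, Finsupp.single_apply, add_left_inj, smul_ite, smul_zero]

/-- The exact sequence `0 → M[T] → M[T] → M → 0` of `K[t,σ]`-modules. -/
abbrev polyComplex (M : SigmaModule k K) : ShortComplex (ModuleCat.{u} (SkewRing k K)) :=
  ShortComplex.mk M.polyDiff M.polyEval (poly_hom_ext fun m => by
    rw [ModuleCat.comp_apply, polyDiff_single_zero, map_sub, polyEval_single, polyEval_single,
      pow_zero, pow_one, one_smul, sub_self]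
    rfl)

/-- Finite support starts a descending induction. Applied to the coefficients of a kernel element of
`T - t`, it shows that this map is injective. -/
lemma eq_zero_of_descending {A : Type*} [AddCommGroup A] (f : ℕ →₀ A) (φ : A →+ A)
    (h : ∀ n, f n = φ (f (n + 1))) : f = 0 := by
  have hb : ∃ N, ∀ n, N ≤ n → f n = 0 := by
    refine ⟨f.support.sup id + 1, fun n hn => ?_⟩
    by_contra hne
    have := Finset.le_sup (f := id) (Finsupp.mem_support_iff.mpr hne)
    simp only [id] at this
    omega
  obtain ⟨N, hN⟩ := hb
  have : ∀ j n, N ≤ n + j → f n = 0 := by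
    intro j
    induction j with
    | zero => exact fun n hn => hN n hn
    | succ j ih => exact fun n hn => by rw [h, ih (n + 1) (by omega), map_zero]
  ext n
  exact this N n (by omega)

/-- Modulo the image of `T - t`, every element of `M[T]` is congruent to the constant given by its
evaluation at `T = t`; this is exactness in the middle. -/
lemma polyComplex_shortExact (M : SigmaModule k K) : M.polyComplex.ShortExact := by
  refine ShortComplex.ShortExact.mk' ?_ ?_ ?_
  · rw [ShortComplex.moduleCat_exact_iff]
    intro f hf
    have key : ∀ f : M.poly.carrier, ∃ g : M.poly.carrier,
        f - M.polySingle 0 (M.polyEval.hom f) = M.polyDiff.hom g := by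
      intro f
      induction f using poly_induction with
      | zero => exact ⟨0, by simp⟩
      | add f f' hf hf' =>
        obtain ⟨g, hg⟩ := hf
        obtain ⟨g', hg'⟩ := hf'
        refine ⟨g + g', ?_⟩
        have h1 : M.polyDiff.hom (g + g') = M.polyDiff.hom g + M.polyDiff.hom g' :=
          map_add M.polyDiff.hom g g'
        rw [map_add, map_add, h1, ← hg, ← hg']
        abel
      | single n m =>
        induction n generalizing m with
        | zero => exact ⟨0, by rw [polyEval_single_zero, sub_self, map_zero]⟩
        | succ n ih =>
          -- `T ^ (n + 1) m` differs from `T ^ n (t m)` by `(T - t) (T ^ n m)`.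
          obtain ⟨g, hg⟩ := ih ((X : K[X]) • m)
          refine ⟨g + M.polySingle n m, ?_⟩
          rw [map_add, ← hg, polyDiff_single, polyEval_single, polyEval_single, smul_smul,
            ← pow_succ]
          abel
    obtain ⟨g, hg⟩ := key f
    have hf' : M.polyEval.hom f = 0 := hf
    rw [hf', map_zero] at hg
    replace hg := (sub_zero (G := M.poly.carrier) f).symm.trans hg
    exact ⟨g, hg.symm⟩
  · rw [ModuleCat.mono_iff_injective]
    refine (injective_iff_map_eq_zero M.polyDiff.hom).mpr fun f hf => ?_
    apply polyCoeff_injective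
    rw [map_zero]
    refine eq_zero_of_descending _ (DistribSMul.toAddMonoidHom M.carrier (X : K[X])) fun n => ?_
    have := polyCoeff_polyDiff f n
    rw [hf, map_zero, Finsupp.zero_apply] at this
    exact (sub_eq_zero.mp this.symm)
  · rw [ModuleCat.epi_iff_surjective]
    exact fun m => ⟨M.polySingle 0 m, polyEval_single_zero m⟩

end SigmaModule

end SkewModules

/-! ### Splitting extensions over `K[σ]` with constant `t`-defect. -/

section Functionals

variable {k K : Type u} [Field k] [Fintype k] [Field K] [Algebra k K]

namespace SigmaModule

variable {M : SigmaModule k K}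

/-- A `K`-linear map `x` from a `σ`-module to a `K`-algebra with `x (σ m) = x m ^ q`. -/
structure IsFunctional {L : Type*} [CommRing L] [Algebra K L] (x : M.carrier →+ L) : Prop where
  smul : ∀ (c : K) m, x ((C c : K[X]) • m) = algebraMap K L c * x m
  sigma : ∀ m, x (M.sigma m) = x m ^ Fintype.card k

/-- `M` is finitely generated as a module over `K[σ]`. -/
def SigmaFinite (M : SigmaModule k K) : Prop :=
  ∃ s : Finset M.carrier, ∀ N : AddSubgroup M.carrier,
    (∀ (c : K), ∀ m ∈ N, (C c : K[X]) • m ∈ N) → (∀ m ∈ N, M.sigma m ∈ N) → (∀ m ∈ s, m ∈ N) → N = ⊤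

/-- The coboundary map `h ↦ τ h - h σ` from `K`-linear maps `M → L[t]` to `τ`-semilinear maps
hits all `τ`-semilinear maps with values in `K[t]`. -/
def CoboundarySurjective (M : SigmaModule k K) (L : Type u) [Field L] [Algebra k L] [Algebra K L] :
    Prop :=
  ∀ δ : M.carrier →+ K[X], (∀ (c : K) m, δ ((C c : K[X]) • m) = C (c ^ Fintype.card k) * δ m) →
    ∃ h : M.carrier →+ L[X], (∀ (c : K) m, h ((C c : K[X]) • m) = C (algebraMap K L c) * h m) ∧
      ∀ m, tau k L (h m) - h (M.sigma m) = (δ m).map (algebraMap K L)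

lemma tau_map_algebraMap {L : Type u} [Field L] [Algebra k L] [Algebra K L] (p : K[X]) :
    tau k L (p.map (algebraMap K L)) = (tau k K p).map (algebraMap K L) := by
  ext n
  rw [coeff_tau, coeff_map, coeff_map, coeff_tau, map_pow]

section Descent

variable {L : Type u} [Field L] [Algebra k L] [Algebra K L] (B : AddSubgroup L)
  (hBK : ∀ (c : K), ∀ b ∈ B, algebraMap K L c * b ∈ B) (hBq : ∀ b ∈ B, b ^ Fintype.card k ∈ B)

include hBK hBq

/-- For each `n`, the set of `m` for which the `n`-th coefficient of `h m` lies in `B` is stable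
under `K` and `σ`. Once `n` exceeds the degrees of `h` on a finite generating set, it contains the
generators, hence everything. The bound is uniform in `m`. -/
lemma exists_forall_coeff_mem (hM : M.SigmaFinite) (h : M.carrier →+ L[X])
    (hC : ∀ (c : K) m, h ((C c : K[X]) • m) = C (algebraMap K L c) * h m)
    (hσ : ∀ m n, (tau k L (h m) - h (M.sigma m)).coeff n ∈ B) :
    ∃ D, ∀ n, D ≤ n → ∀ m, (h m).coeff n ∈ B := by
  obtain ⟨s, hs⟩ := hM
  refine ⟨s.sup (fun m => (h m).natDegree) + 1, fun n hn => ?_⟩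
  let N : AddSubgroup M.carrier := B.comap ((lcoeff L n).toAddMonoidHom.comp h)
  have hN : ∀ m, m ∈ N ↔ (h m).coeff n ∈ B := fun m => Iff.rfl
  have : N = ⊤ := by
    refine hs N (fun c m hm => ?_) (fun m hm => ?_) (fun m hm => ?_)
    · rw [hN, hC, coeff_C_mul]
      exact hBK c _ ((hN m).mp hm)
    · have h1 := hσ m n
      rw [coeff_sub, coeff_tau] at h1
      rw [hN, ← sub_sub_cancel ((h m).coeff n ^ Fintype.card k) ((h (M.sigma m)).coeff n)]
      exact B.sub_mem (hBq _ ((hN m).mp hm)) h1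
    · refine (hN m).mpr ?_
      rw [coeff_eq_zero_of_natDegree_lt]
      · exact B.zero_mem
      · have := Finset.le_sup (f := fun m => (h m).natDegree) hm
        exact Nat.lt_of_lt_of_le (Nat.lt_succ_of_le this) hn
  intro m
  rw [← hN, this]
  trivial

/-- Large coefficients lie in `B` by finite generation. Modulo `B`, the `n`-th coefficient at `m`
equals the `(n + 1)`-st coefficient at `t m`, so membership propagates down to degree `0`. The
constant term of the `t`-defect is never needed. -/
lemma coeff_mem_of_equivariant (hM : M.SigmaFinite) (h : M.carrier →+ L[X])
    (hC : ∀ (c : K) m, h ((C c : K[X]) • m) = C (algebraMap K L c) * h m)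
    (hσ : ∀ m n, (tau k L (h m) - h (M.sigma m)).coeff n ∈ B)
    (hX : ∀ m n, (X * h m - h ((X : K[X]) • m)).coeff (n + 1) ∈ B) (m : M.carrier) (n : ℕ) :
    (h m).coeff n ∈ B := by
  obtain ⟨D, hD⟩ := exists_forall_coeff_mem B hBK hBq hM h hC hσ
  have key : ∀ j n, D ≤ n + j → ∀ m, (h m).coeff n ∈ B := by
    intro j
    induction j with
    | zero => exact fun n hn => hD n hn
    | succ j ih =>
      intro n hn m
      have h1 := hX m n
      rw [coeff_sub, coeff_X_mul] at h1
      have h2 := ih (n + 1) (by omega) ((X : K[X]) • m)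
      simpa using B.add_mem h1 h2
  exact key D n (by omega) m

end Descent

/-- This is the case `B = 0` of `coeff_mem_of_equivariant`: two `σ`-equivariant corrections whose
`t`-defects agree modulo constants must coincide. -/
lemma eq_zero_of_equivariant {L : Type u} [Field L] [Algebra k L] [Algebra K L]
    (hM : M.SigmaFinite) (h : M.carrier →+ L[X])
    (hC : ∀ (c : K) m, h ((C c : K[X]) • m) = C (algebraMap K L c) * h m)
    (hσ : ∀ m, tau k L (h m) = h (M.sigma m))
    (hX : ∀ m, ∃ c : L, X * h m - h ((X : K[X]) • m) = C c) (m : M.carrier) : h m = 0 := by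
  ext n
  rw [coeff_zero, ← AddSubgroup.mem_bot]
  refine coeff_mem_of_equivariant ⊥ ?_ ?_ hM h hC ?_ ?_ m n
  · intro c b hb
    rw [AddSubgroup.mem_bot] at hb ⊢
    rw [hb, mul_zero]
  · intro b hb
    rw [AddSubgroup.mem_bot] at hb ⊢
    rw [hb, zero_pow Fintype.card_ne_zero]
  · intro m n
    rw [hσ, sub_self, coeff_zero]
    exact zero_mem _
  · intro m n
    obtain ⟨c, hc⟩ := hX m
    rw [hc, coeff_C_succ]
    exact zero_mem _

lemma exists_addMonoidHom_lift {A B N : Type*} [AddCommGroup A] [AddCommGroup B] [AddCommGroup N]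
    (i : B →+ N) (hi : Function.Injective i) (f : A →+ N) (hf : ∀ a, ∃ b, i b = f a) :
    ∃ g : A →+ B, ∀ a, i (g a) = f a := by
  choose g hg using hf
  exact ⟨AddMonoidHom.mk' g fun a b => hi (by rw [map_add, hg, hg, hg, map_add]), hg⟩

lemma coeff_iterate_divX {L : Type*} [Semiring L] (p : L[X]) (j n : ℕ) :
    (((divX_hom : L[X] →+ L[X]) ^[j]) p).coeff n = p.coeff (n + j) := by
  induction j generalizing n with
  | zero => rfl
  | succ j ih =>
    rw [Function.iterate_succ_apply', divX_hom_toFun, coeff_divX, ih, add_assoc, add_comm 1]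

/-- Division with remainder by `T - t` in `Hom(M, L)[T]`. -/
lemma exists_division {L : Type u} [Field L] [Algebra k L] [Algebra K L]
    (hM : M.SigmaFinite) (y : M.carrier →+ L[X])
    (hC : ∀ (c : K) m, y ((C c : K[X]) • m) = C (algebraMap K L c) * y m)
    (hσ : ∀ m, tau k L (y m) = y (M.sigma m)) :
    ∃ z : M.carrier →+ L[X], (∀ (c : K) m, z ((C c : K[X]) • m) = C (algebraMap K L c) * z m) ∧
      (∀ m, tau k L (z m) = z (M.sigma m)) ∧
      ∀ m n, (y m - (X * z m - z ((X : K[X]) • m))).coeff (n + 1) = 0 := by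
  obtain ⟨D, hD⟩ := exists_forall_coeff_mem (⊥ : AddSubgroup L)
    (by intro c b hb; rw [AddSubgroup.mem_bot] at hb ⊢; rw [hb, mul_zero])
    (by intro b hb; rw [AddSubgroup.mem_bot] at hb ⊢; rw [hb, zero_pow Fintype.card_ne_zero])
    hM y hC (by intro m n; rw [hσ, sub_self, coeff_zero]; exact zero_mem _)
  -- If `y = ∑ yₙ Tⁿ` with `yₙ : M → L`, the quotient by `T - t` has coefficients `zₙ = ∑ᵢ yₙ₊ᵢ₊₁ ∘
  -- tⁱ`; the sum stops because `yₙ = 0` for `n ≥ D`.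
  let z : M.carrier →+ L[X] := ∑ i ∈ Finset.range D,
    AddMonoidHom.comp (HPow.hPow (α := AddMonoid.End L[X]) divX_hom (i + 1))
      (y.comp (DistribSMul.toAddMonoidHom M.carrier (X ^ i : K[X])))
  have hz : ∀ m n, (z m).coeff n =
      ∑ i ∈ Finset.range D, (y ((X ^ i : K[X]) • m)).coeff (n + (i + 1)) := by
    intro m n
    rw [AddMonoidHom.finsetSum_apply, finsetSum_coeff]
    refine Finset.sum_congr rfl fun i _ => ?_
    rw [← coeff_iterate_divX]
    rfl
  refine ⟨z, fun c m => ?_, fun m => ?_, fun m n => ?_⟩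
  · ext n
    rw [coeff_C_mul, hz, hz, Finset.mul_sum]
    refine Finset.sum_congr rfl fun i _ => ?_
    rw [smul_comm, hC, coeff_C_mul]
  · ext n
    rw [coeff_tau, hz, hz]
    have : (∑ i ∈ Finset.range D, (y ((X ^ i : K[X]) • m)).coeff (n + (i + 1))) ^ Fintype.card k =
        ∑ i ∈ Finset.range D, (y ((X ^ i : K[X]) • m)).coeff (n + (i + 1)) ^ Fintype.card k :=
      map_sum (FiniteField.frobeniusAlgHom k L) _ _
    rw [this]
    refine Finset.sum_congr rfl fun i _ => ?_
    rw [← coeff_tau, hσ, M.sigma.map_smulₛₗ, map_pow (tau k K), tau_X]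
  · rw [coeff_sub, coeff_sub, coeff_X_mul, hz, hz, ← Finset.sum_sub_distrib]
    have : ∀ i ∈ Finset.range D, (y ((X ^ i : K[X]) • m)).coeff (n + (i + 1)) -
        (y ((X ^ i : K[X]) • (X : K[X]) • m)).coeff (n + 1 + (i + 1)) =
        (fun i => (y ((X ^ i : K[X]) • m)).coeff (n + (i + 1))) i -
        (fun i => (y ((X ^ i : K[X]) • m)).coeff (n + (i + 1))) (i + 1) := by
      intro i _
      simp only
      rw [smul_smul, ← pow_succ, show n + 1 + (i + 1) = n + (i + 1 + 1) by omega]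
    -- The sum telescopes to the `(n + 1)`-st coefficient of `y m` minus a coefficient of degree `n
    -- + D + 1`, which vanishes.
    rw [Finset.sum_congr rfl this, Finset.sum_range_sub']
    have h0 := hD (n + (D + 1)) (by omega) ((X ^ D : K[X]) • m)
    rw [AddSubgroup.mem_bot] at h0
    simp [h0]

lemma unit_ofPoly_smul {N : ModuleCat.{u} (SkewRing k K)} (i : (unit k K).toModuleCat ⟶ N)
    (p r : K[X]) : i.hom (p * r : K[X]) = SkewRing.ofPoly k K p • i.hom r := by
  let : Module (SkewRing k K) K[X] := (unit k K).toModuleCat.isModule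
  refine Eq.trans ?_ (i.hom.map_smul (SkewRing.ofPoly k K p) r)
  exact congrArg i.hom ((unit k K).ofPoly_smul p r).symm

lemma unit_sigma_smul {N : ModuleCat.{u} (SkewRing k K)} (i : (unit k K).toModuleCat ⟶ N)
    (r : K[X]) : i.hom (tau k K r) = SkewRing.sigma k K • i.hom r := by
  let : Module (SkewRing k K) K[X] := (unit k K).toModuleCat.isModule
  refine Eq.trans ?_ (i.hom.map_smul (SkewRing.sigma k K) r)
  exact congrArg i.hom ((unit k K).sigma_smul r).symm

/-- An extension of a `σ`-module `M` by `K[t]` is split by a `K[σ]`-linear map `s` for which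
`t s - s t` takes values in `K`. -/
lemma exists_section (hM : M.SigmaFinite) {L : Type u} [Field L] [Algebra k L] [Algebra K L]
    (hL : M.CoboundarySurjective L) {N : ModuleCat.{u} (SkewRing k K)}
    (i : (unit k K).toModuleCat ⟶ N) (π : N ⟶ M.toModuleCat) (w : i ≫ π = 0)
    (hS : (ShortComplex.mk i π w).ShortExact) :
    ∃ (y : M.carrier →+ K) (s : M.carrier →+ N), IsFunctional y ∧ IsScalarEquivariant s ∧
      (∀ m, π.hom (s m) = m) ∧
      ∀ m, SkewRing.ofPoly k K X • s m - s ((X : K[X]) • m) = i.hom (C (y m) : K[X]) := by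
  have hinj : Function.Injective i.hom := (ModuleCat.mono_iff_injective i).mp hS.mono_f
  have hsurj : Function.Surjective π.hom := (ModuleCat.epi_iff_surjective π).mp hS.epi_g
  have hex : ∀ n : N, π.hom n = 0 → ∃ p : K[X], i.hom p = n := fun n hn =>
    (ShortComplex.moduleCat_exact_iff _).mp hS.exact n hn
  let iAdd : K[X] →+ N := i.hom.toAddMonoidHom
  have iAdd_apply : ∀ p : K[X], iAdd p = i.hom p := fun _ => rfl
  have hiinj : Function.Injective iAdd := hinj
  have iC : ∀ p r : K[X], iAdd (p * r) = SkewRing.ofPoly k K p • iAdd r := unit_ofPoly_smul i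
  have iσ : ∀ r : K[X], iAdd (tau k K r) = SkewRing.sigma k K • iAdd r := unit_sigma_smul i
  have πp : ∀ (p : K[X]) (n : N), π.hom (SkewRing.ofPoly k K p • n) = p • π.hom n := by
    intro p n
    rw [map_smul]
    exact M.ofPoly_smul _ _
  have πσ : ∀ (n : N), π.hom (SkewRing.sigma k K • n) = M.sigma (π.hom n) := by
    intro n
    rw [map_smul]
    exact M.sigma_smul _
  -- a `K`-linear section
  obtain ⟨s₀, hs₀C, hs₀⟩ : ∃ s₀ : M.carrier →+ N,
      (∀ (c : K) m, s₀ ((C c : K[X]) • m) = SkewRing.ofPoly k K (C c) • s₀ m) ∧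
      ∀ m, π.hom (s₀ m) = m := by
    let : Module K M.carrier := M.scalarModule
    let : Module K N := Module.compHom N ((SkewRing.ofPoly k K).comp C)
    let πK : N →ₗ[K] M.carrier := { π.hom.toAddMonoidHom with map_smul' := fun c n => πp (C c) n }
    obtain ⟨s, hs⟩ := πK.exists_rightInverse_of_surjective (LinearMap.range_eq_top.mpr hsurj)
    exact ⟨s.toAddMonoidHom, fun c m => s.map_smul c m, fun m => LinearMap.congr_fun hs m⟩
  let Xend : M.carrier →+ M.carrier := DistribSMul.toAddMonoidHom M.carrier (X : K[X])
  -- `δ` and, below, `ε` measure the failure of `s₀` to commute with `σ` and with `t`; both defects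
  -- die in `M`, so they take values in `K[t]`.
  obtain ⟨δ, hδ⟩ := exists_addMonoidHom_lift iAdd hiinj
    ((DistribSMul.toAddMonoidHom N (SkewRing.sigma k K)).comp s₀ -
      s₀.comp M.sigma.toAddMonoidHom) (by
    intro m
    refine hex _ ?_
    change π.hom (SkewRing.sigma k K • s₀ m - s₀ (M.sigma m)) = 0
    rw [map_sub, πσ, hs₀, hs₀, sub_self])
  obtain ⟨ε, hε⟩ := exists_addMonoidHom_lift iAdd hiinj
    ((DistribSMul.toAddMonoidHom N (SkewRing.ofPoly k K X)).comp s₀ - s₀.comp Xend) (by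
    intro m
    refine hex _ ?_
    change π.hom (SkewRing.ofPoly k K X • s₀ m - s₀ ((X : K[X]) • m)) = 0
    rw [map_sub, πp, hs₀, hs₀, sub_self])
  replace hδ : ∀ m, iAdd (δ m) = SkewRing.sigma k K • s₀ m - s₀ (M.sigma m) := hδ
  replace hε : ∀ m, iAdd (ε m) = SkewRing.ofPoly k K X • s₀ m - s₀ ((X : K[X]) • m) := hε
  have hδC : ∀ (c : K) m, δ ((C c : K[X]) • m) = C (c ^ Fintype.card k) * δ m := by
    intro c m
    apply hiinj
    rw [iC, hδ, hδ, hs₀C, M.sigma.map_smulₛₗ, tau_C, hs₀C, smul_sub, ← mul_smul,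
      SkewRing.sigma_mul_ofPoly, tau_C, mul_smul]
  have hεC : ∀ (c : K) m, ε ((C c : K[X]) • m) = C c * ε m := by
    intro c m
    apply hiinj
    rw [iC, hε, hε, hs₀C, smul_comm (X : K[X]) (C c : K[X]) m, hs₀C, smul_sub, ← mul_smul,
      ← mul_smul, ← map_mul, ← map_mul, mul_comm]
  -- The cocycle relation, forced by `t σ = σ t`.
  have hδε : ∀ m, X * δ m - δ ((X : K[X]) • m) = tau k K (ε m) - ε (M.sigma m) := by
    intro m
    apply hiinj
    have h1 : SkewRing.ofPoly k K X • SkewRing.sigma k K • s₀ m =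
        SkewRing.sigma k K • SkewRing.ofPoly k K X • s₀ m := by
      rw [← mul_smul, ← mul_smul, SkewRing.sigma_mul_ofPoly, tau_X]
    have h2 : M.sigma ((X : K[X]) • m) = (X : K[X]) • M.sigma m := by
      rw [M.sigma.map_smulₛₗ, tau_X]
    rw [map_sub, map_sub, iC, iσ, hδ, hδ, hε, hε, smul_sub, smul_sub, h1, h2]
    abel
  obtain ⟨h₁, h₁C, h₁σ⟩ := hL δ hδC
  let mapL : K[X] →+ L[X] := (Polynomial.mapRingHom (algebraMap K L)).toAddMonoidHom
  have mapL_apply : ∀ p, mapL p = p.map (algebraMap K L) := fun _ => rfl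
  -- The `t`-defect which remains after `h₁` has removed `δ`. By `hδε` it is `σ`-equivariant, so it
  -- can be divided by `T - t`.
  let y : M.carrier →+ L[X] :=
    mapL.comp ε - ((AddMonoidHom.mulLeft X).comp h₁ - h₁.comp Xend)
  have hy : ∀ m, y m = (ε m).map (algebraMap K L) - (X * h₁ m - h₁ ((X : K[X]) • m)) :=
    fun m => rfl
  obtain ⟨z, hzC, hzσ, hz⟩ := exists_division hM y
    (by
      intro c m
      rw [hy, hy, hεC, h₁C, smul_comm (X : K[X]) (C c : K[X]) m, h₁C, Polynomial.map_mul, map_C]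
      ring)
    (by
      intro m
      have h2 : M.sigma ((X : K[X]) • m) = (X : K[X]) • M.sigma m := by
        rw [M.sigma.map_smulₛₗ, tau_X]
      have h3 : tau k L (h₁ m) = h₁ (M.sigma m) + (δ m).map (algebraMap K L) := by
        rw [← h₁σ]; ring
      have h4 : tau k L (h₁ ((X : K[X]) • m)) =
          h₁ ((X : K[X]) • M.sigma m) + (δ ((X : K[X]) • m)).map (algebraMap K L) := by
        rw [← h₁σ, h2]; ring
      have h5 := congrArg (Polynomial.map (algebraMap K L)) (hδε m)
      rw [Polynomial.map_sub, Polynomial.map_sub, Polynomial.map_mul, map_X] at h5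
      rw [hy, hy, map_sub, map_sub, map_mul, tau_X, tau_map_algebraMap, h3, h4]
      linear_combination -h5)
  -- The correction `h₁ + z` has `σ`-defect `δ`, and its `t`-defect agrees with `ε` in positive
  -- degrees. Both have coefficients in `K`, so `h₁ + z` takes values in `K[t]`.
  have hmem := coeff_mem_of_equivariant (algebraMap K L).range.toAddSubgroup
    (fun c b hb => (algebraMap K L).range.mul_mem (RingHom.mem_range_self _ c) hb)
    (fun b hb => (algebraMap K L).range.pow_mem hb _) hM (h₁ + z)
    (fun c m => by rw [AddMonoidHom.add_apply, h₁C, hzC, AddMonoidHom.add_apply, mul_add])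
    (fun m n => by
      rw [AddMonoidHom.add_apply, AddMonoidHom.add_apply, map_add, hzσ, add_sub_add_right_eq_sub,
        h₁σ, coeff_map]
      exact ⟨_, rfl⟩)
    (fun m n => by
      have h1 := hz m n
      have h2 : X * (h₁ + z) m - (h₁ + z) ((X : K[X]) • m) = (ε m).map (algebraMap K L) -
          (y m - (X * z m - z ((X : K[X]) • m))) := by
        rw [hy, AddMonoidHom.add_apply, AddMonoidHom.add_apply]
        ring
      rw [h2, coeff_sub, h1, sub_zero, coeff_map]
      exact ⟨_, rfl⟩)
  have hmapinj : Function.Injective mapL := Polynomial.map_injective _ (algebraMap K L).injective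
  obtain ⟨h, hh⟩ := exists_addMonoidHom_lift mapL hmapinj (h₁ + z) (by
    intro m
    have : (h₁ + z) m ∈ Polynomial.lifts (algebraMap K L) := by
      rw [lifts_iff_coeff_lifts]
      exact fun n => hmem m n
    obtain ⟨p, hp⟩ := this
    exact ⟨p, hp⟩)
  have hhC : ∀ (c : K) m, h ((C c : K[X]) • m) = C c * h m := by
    intro c m
    apply hmapinj
    rw [hh, mapL_apply, Polynomial.map_mul, map_C, ← mapL_apply, hh, AddMonoidHom.add_apply, h₁C,
      hzC, AddMonoidHom.add_apply, mul_add]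
  have hhσ : ∀ m, tau k K (h m) - h (M.sigma m) = δ m := by
    intro m
    apply hmapinj
    rw [map_sub, hh, mapL_apply, ← tau_map_algebraMap, ← mapL_apply, hh, mapL_apply, ← h₁σ,
      AddMonoidHom.add_apply, AddMonoidHom.add_apply, map_add, hzσ]
    ring
  have hhX : ∀ m, ε m - (X * h m - h ((X : K[X]) • m)) =
      C ((ε m - (X * h m - h ((X : K[X]) • m))).coeff 0) := by
    intro m
    ext n
    cases n with
    | zero => rw [coeff_C_zero]
    | succ n =>
      rw [coeff_C_succ]
      apply (algebraMap K L).injective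
      have e : (ε m - (X * h m - h ((X : K[X]) • m))).map (algebraMap K L) =
          y m - (X * z m - z ((X : K[X]) • m)) := by
        rw [Polynomial.map_sub, Polynomial.map_sub, Polynomial.map_mul, map_X, ← mapL_apply (h m),
          ← mapL_apply (h _), hh, hh, hy, AddMonoidHom.add_apply, AddMonoidHom.add_apply]
        ring
      rw [← coeff_map, e, hz, map_zero]
  let y₀ : M.carrier →+ K := (lcoeff K 0).toAddMonoidHom.comp
    (ε - ((AddMonoidHom.mulLeft X).comp h - h.comp Xend))
  have hy₀ : ∀ m, ε m - (X * h m - h ((X : K[X]) • m)) = C (y₀ m) := hhX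
  -- The corrected section commutes with `σ`, and its `t`-defect is the constant `y₀`, which is a
  -- functional by the cocycle relation.
  refine ⟨y₀, s₀ - iAdd.comp h, ⟨fun c m => ?_, fun m => ?_⟩, ⟨fun c m => ?_, fun m => ?_⟩,
    fun m => ?_, fun m => ?_⟩
  · apply C_injective
    rw [← hy₀, hεC, hhC, smul_comm (X : K[X]) (C c : K[X]) m, hhC, map_mul, ← hy₀,
      Algebra.algebraMap_self_apply]
    ring
  · apply C_injective
    have h2 : M.sigma ((X : K[X]) • m) = (X : K[X]) • M.sigma m := by
      rw [M.sigma.map_smulₛₗ, tau_X]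
    have h6 := hhσ ((X : K[X]) • m)
    rw [h2] at h6
    rw [← tau_C, ← hy₀, ← hy₀, map_sub, map_sub, map_mul, tau_X]
    linear_combination hδε m + X * hhσ m - h6
  · change s₀ _ - iAdd (h _) = _ • (s₀ m - iAdd (h m))
    rw [hs₀C, hhC, iC, smul_sub]
  · change s₀ _ - iAdd (h _) = _ • (s₀ m - iAdd (h m))
    rw [smul_sub, ← iσ, ← sub_eq_zero]
    have := hδ m
    rw [← hhσ, map_sub] at this
    rw [sub_eq_iff_eq_add] at this
    rw [this]
    abel
  · change π.hom (s₀ m - i.hom (h m)) = m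
    have : π.hom (i.hom (h m)) = 0 := ConcreteCategory.congr_hom w (h m)
    rw [map_sub, hs₀, this, sub_zero]
  · change SkewRing.ofPoly k K X • (s₀ m - iAdd (h m)) - (s₀ _ - iAdd (h _)) = iAdd _
    rw [← hy₀, map_sub, map_sub, hε, iC, smul_sub]
    abel

end SigmaModule

end Functionals

/-! ### From functionals to classes in `Ext¹`. -/

section ExtClasses

/-- Every element of `Ext¹` in a category of modules is the class of an extension. -/
lemma exists_extClass_eq {R : Type u} [Ring R] {A B : ModuleCat.{u} R}
    (e : Abelian.Ext.{u} A B 1) :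
    ∃ (N : ModuleCat.{u} R) (i : B ⟶ N) (π : N ⟶ A) (w : i ≫ π = 0)
      (hS : (ShortComplex.mk i π w).ShortExact), hS.extClass = e := by
  -- `B` is embedded in an injective module. Since `Ext¹(A, -)` vanishes there, `e` is the image
  -- under the connecting map of some `ψ : A → S.X₃`, and the extension sought is the pull-back of
  -- `S` along `ψ`.
  let S := ShortComplex.mk _ _ (Limits.cokernel.condition (Injective.ι B))
  have hS : S.ShortExact :=
    { exact := ShortComplex.exact_of_g_is_cokernel _ (Limits.cokernelIsCokernel S.f) }
  obtain ⟨ψ₀, hψ₀⟩ := Abelian.Ext.covariant_sequence_exact₁ A hS e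
    (Abelian.Ext.eq_zero_of_injective _) rfl
  obtain ⟨ψ, rfl⟩ := Abelian.Ext.homEquiv₀.symm.surjective ψ₀
  have hinj : Function.Injective S.f.hom := (ModuleCat.mono_iff_injective S.f).mp hS.mono_f
  have hsurj : Function.Surjective S.g.hom := (ModuleCat.epi_iff_surjective S.g).mp hS.epi_g
  have hex : ∀ n, S.g.hom n = 0 → ∃ b, S.f.hom b = n := fun n hn =>
    (ShortComplex.moduleCat_exact_iff _).mp hS.exact n hn
  have hfg : ∀ b, S.g.hom (S.f.hom b) = 0 := fun b => ConcreteCategory.congr_hom S.zero b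
  let P : Submodule R (S.X₂ × A) :=
    LinearMap.eqLocus (S.g.hom.comp (LinearMap.fst R S.X₂ A)) (ψ.hom.comp (LinearMap.snd R S.X₂ A))
  have hP : ∀ x : S.X₂ × A, x ∈ P ↔ S.g.hom x.1 = ψ.hom x.2 := fun x => Iff.rfl
  let i : B ⟶ ModuleCat.of R P := ModuleCat.ofHom ((LinearMap.prod S.f.hom 0).codRestrict P
    (fun b => by rw [hP]; simp [hfg]))
  let π : ModuleCat.of R P ⟶ A := ModuleCat.ofHom ((LinearMap.snd R S.X₂ A).comp P.subtype)
  have w : i ≫ π = 0 := by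
    ext b
    rfl
  have hN : (ShortComplex.mk i π w).ShortExact := by
    refine ShortComplex.ShortExact.mk' ?_ ?_ ?_
    · rw [ShortComplex.moduleCat_exact_iff]
      rintro ⟨⟨n, a⟩, hna⟩ ha
      replace ha : a = 0 := ha
      subst ha
      rw [hP, map_zero] at hna
      obtain ⟨b, rfl⟩ := hex n hna
      exact ⟨b, rfl⟩
    · rw [ModuleCat.mono_iff_injective]
      intro b b' h
      exact hinj (congrArg (fun x : P => x.1.1) h)
    · rw [ModuleCat.epi_iff_surjective]
      intro a
      obtain ⟨n, hn⟩ := hsurj (ψ.hom a)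
      exact ⟨⟨(n, a), hn⟩, rfl⟩
  refine ⟨_, i, π, w, hN, ?_⟩
  let f : ShortComplex.mk i π w ⟶ S :=
    { τ₁ := 𝟙 B
      τ₂ := ModuleCat.ofHom ((LinearMap.fst R S.X₂ A).comp P.subtype)
      τ₃ := ψ
      comm₁₂ := by ext b; rfl
      comm₂₃ := by ext x; exact x.2 }
  have h := ShortComplex.ShortExact.extClass_naturality hN hS f
  rw [← hψ₀]
  refine Eq.trans ?_ h
  exact (Abelian.Ext.comp_mk₀_id _).symm

variable {k K : Type u} [Field k] [Fintype k] [Field K] [Algebra k K]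

namespace SigmaModule

variable {M : SigmaModule k K}

lemma isScalarEquivariant_of_isFunctional {x : M.carrier →+ K} (hx : IsFunctional x) :
    IsScalarEquivariant (N := (unit k K).toModuleCat) ((C : K →+* K[X]).toAddMonoidHom.comp x) where
  smul c m := by
    refine Eq.trans ?_ ((unit k K).ofPoly_smul (C c) (C (x m))).symm
    change C (x _) = C c * C (x m)
    rw [hx.smul, map_mul, Algebra.algebraMap_self_apply]
  sigma m := by
    refine Eq.trans ?_ ((unit k K).sigma_smul (C (x m))).symm
    change C (x _) = tau k K (C (x m))
    rw [hx.sigma, tau_C]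

/-- The `K[t,σ]`-linear map `M[T] → K[T]` given by a functional `M → K`. -/
def functionalHom (x : M.carrier →+ K) (hx : IsFunctional x) :
    M.poly.toModuleCat ⟶ (unit k K).toModuleCat :=
  polyLift _ (isScalarEquivariant_of_isFunctional hx)

lemma functionalHom_single_zero (x : M.carrier →+ K) (hx : IsFunctional x) (m : M.carrier) :
    (functionalHom x hx).hom (M.polySingle 0 m) = (C (x m) : K[X]) :=
  polyLift_single_zero _ _ m

lemma functionalHom_single_one (x : M.carrier →+ K) (hx : IsFunctional x) (m : M.carrier) :
    (functionalHom x hx).hom (M.polySingle 1 m) = (X * C (x m) : K[X]) := by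
  refine (polyLift_single _ _ 1 m).trans ?_
  rw [pow_one]
  exact (unit k K).ofPoly_smul X (C (x m))

/-- The class in `Ext¹(M, K[t])` of the push-out of `0 → M[T] → M[T] → M → 0` along the map
`M[T] → K[T]` given by a functional. -/
def functionalExt (x : M.carrier →+ K) (hx : IsFunctional x) :
    Abelian.Ext.{u} M.toModuleCat (unit k K).toModuleCat 1 :=
  M.polyComplex_shortExact.extClass.comp (Abelian.Ext.mk₀ (functionalHom x hx)) (add_zero 1)

/-- The section extends to `M[T] → N`, which together with the identity of `M` gives a morphism from
the resolution to the extension. On the kernels it induces `functionalHom x`, because the latter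
records the `t`-defect of `s`. -/
lemma functionalExt_eq_extClass {N : ModuleCat.{u} (SkewRing k K)}
    (i : (unit k K).toModuleCat ⟶ N) (π : N ⟶ M.toModuleCat) (w : i ≫ π = 0)
    (hS : (ShortComplex.mk i π w).ShortExact) (x : M.carrier →+ K) (hx : IsFunctional x)
    (s : M.carrier →+ N) (hs : IsScalarEquivariant s) (hπ : ∀ m, π.hom (s m) = m)
    (hX : ∀ m, SkewRing.ofPoly k K X • s m - s ((X : K[X]) • m) = i.hom (C (x m) : K[X])) :
    functionalExt x hx = hS.extClass := by
  let f : M.polyComplex ⟶ ShortComplex.mk i π w :=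
    { τ₁ := functionalHom x hx
      τ₂ := polyLift s hs
      τ₃ := 𝟙 _
      comm₁₂ := by
        apply poly_hom_ext
        intro m
        change i.hom ((functionalHom x hx).hom _) = (polyLift s hs).hom (M.polyDiff.hom _)
        rw [functionalHom_single_zero, polyDiff_single_zero, map_sub, polyLift_single,
          polyLift_single_zero, ← hX, pow_one]
      comm₂₃ := by
        apply poly_hom_ext
        intro m
        change π.hom ((polyLift s hs).hom _) = M.polyEval.hom _
        rw [polyLift_single_zero, polyEval_single_zero, hπ] }
  refine (ShortComplex.ShortExact.extClass_naturality M.polyComplex_shortExact hS f).trans ?_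
  exact Abelian.Ext.mk₀_id_comp _

lemma functionalExt_surjective (hM : M.SigmaFinite) {L : Type u} [Field L] [Algebra k L]
    [Algebra K L] (hL : M.CoboundarySurjective L)
    (e : Abelian.Ext.{u} M.toModuleCat (unit k K).toModuleCat 1) :
    ∃ (x : M.carrier →+ K) (hx : IsFunctional x), functionalExt x hx = e := by
  obtain ⟨N, i, π, w, hS, rfl⟩ := exists_extClass_eq e
  obtain ⟨x, s, hx, hs, hπ, hX⟩ := exists_section hM hL i π w hS
  exact ⟨x, hx, functionalExt_eq_extClass i π w hS x hx s hs hπ hX⟩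

/-- A trivial class means that `functionalHom x` factors through `T - t`. On the constants `M ⊂
M[T]` the factor is `σ`-equivariant with constant `t`-defect `x`, so it vanishes, and with it `x`.
-/
lemma functionalExt_eq_zero (hM : M.SigmaFinite) (x : M.carrier →+ K) (hx : IsFunctional x)
    (h : functionalExt x hx = 0) : x = 0 := by
  obtain ⟨z₀, hz₀⟩ := Abelian.Ext.contravariant_sequence_exact₁ M.polyComplex_shortExact _ _
    (add_zero 1) h
  obtain ⟨z, rfl⟩ := Abelian.Ext.homEquiv₀.symm.surjective z₀
  have hz : M.polyDiff ≫ z = functionalHom x hx := by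
    apply Abelian.Ext.homEquiv₀.symm.injective
    refine Eq.trans ?_ hz₀
    exact (Abelian.Ext.mk₀_comp_mk₀ _ _).symm
  let zp : M.poly.carrier →+ K[X] := z.hom.toAddMonoidHom
  let d : M.carrier →+ K[X] := zp.comp (M.polySingle 0)
  have zC : ∀ (p : K[X]) (f : M.poly.carrier), zp (p • f) = p * zp f := by
    intro p f
    let : Module (SkewRing k K) K[X] := (unit k K).toModuleCat.isModule
    have h1 := z.hom.map_smul (SkewRing.ofPoly k K p) f
    rw [M.poly.ofPoly_smul] at h1
    exact h1.trans ((unit k K).ofPoly_smul p _)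
  have zσ : ∀ (f : M.poly.carrier), zp (M.poly.sigma f) = tau k K (zp f) := by
    intro f
    let : Module (SkewRing k K) K[X] := (unit k K).toModuleCat.isModule
    have h1 := z.hom.map_smul (SkewRing.sigma k K) f
    rw [M.poly.sigma_smul] at h1
    exact h1.trans ((unit k K).sigma_smul _)
  have hd : ∀ m, X * d m - d ((X : K[X]) • m) = C (x m) := by
    intro m
    rw [← functionalHom_single_zero x hx, ← hz]
    change X * zp (M.polySingle 0 m) - zp _ = zp (M.polyDiff.hom _)
    rw [polyDiff_single_zero, ← zC, X_smul_polySingle]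
    exact (map_sub zp _ _).symm
  have hd0 := eq_zero_of_equivariant (L := K) hM d
    (fun c m => by
      change zp _ = C c * zp _
      rw [← zC, C_smul_polySingle])
    (fun m => by
      change tau k K (zp _) = zp _
      rw [← zσ, sigma_polySingle])
    (fun m => ⟨x m, hd m⟩)
  ext m
  have := hd m
  rw [hd0, hd0, mul_zero, sub_zero, eq_comm, C_eq_zero] at this
  exact this

/-- The map `f` induces a morphism of resolutions, and the functional `y` on `M[T]` factors through
it; the rest is naturality of the connecting class. -/
lemma functionalExt_comp {M' : SigmaModule k K} (f : M.carrier →ₗ[K[X]] M'.carrier)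
    (hf : ∀ m, f (M.sigma m) = M'.sigma (f m)) (x : M'.carrier →+ K) (hx : IsFunctional x)
    (y : M.carrier →+ K) (hy : IsFunctional y) (hxy : ∀ m, y m = x (f m)) :
    functionalExt y hy = (Abelian.Ext.mk₀ (homOfLinear f hf)).comp (functionalExt x hx)
      (zero_add 1) := by
  let g : M.poly.toModuleCat ⟶ M'.poly.toModuleCat :=
    polyLift ((M'.polySingle 0).comp f.toAddMonoidHom)
      ⟨fun c m => by
        rw [ofPoly_smul, AddMonoidHom.comp_apply, AddMonoidHom.comp_apply, C_smul_polySingle]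
        exact congrArg _ (f.map_smul _ _),
      fun m => by
        rw [sigma_smul, AddMonoidHom.comp_apply, AddMonoidHom.comp_apply, sigma_polySingle]
        exact congrArg _ (hf m)⟩
  have hg0 : ∀ m, g.hom (M.polySingle 0 m) = M'.polySingle 0 (f m) := fun m =>
    polyLift_single_zero _ _ m
  have hg1 : ∀ m, g.hom (M.polySingle 1 m) = M'.polySingle 1 (f m) := fun m => by
    refine (polyLift_single _ _ 1 m).trans ?_
    rw [ofPoly_smul, pow_one]
    exact X_smul_polySingle 0 (f m)
  let φ : M.polyComplex ⟶ M'.polyComplex :=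
    { τ₁ := g
      τ₂ := g
      τ₃ := homOfLinear f hf
      comm₁₂ := by
        apply poly_hom_ext
        intro m
        change M'.polyDiff.hom (g.hom _) = g.hom (M.polyDiff.hom _)
        rw [hg0, polyDiff_single_zero, polyDiff_single_zero, map_sub, hg0, hg1, f.map_smul]
      comm₂₃ := by
        apply poly_hom_ext
        intro m
        change M'.polyEval.hom (g.hom _) = f (M.polyEval.hom _)
        rw [hg0, polyEval_single_zero, polyEval_single_zero] }
  have h1 : functionalHom y hy = g ≫ functionalHom x hx := by
    apply poly_hom_ext
    intro m
    change _ = (functionalHom x hx).hom (g.hom _)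
    rw [hg0, functionalHom_single_zero, functionalHom_single_zero, hxy]
  have h2 := ShortComplex.ShortExact.extClass_naturality M.polyComplex_shortExact
    M'.polyComplex_shortExact φ
  rw [functionalExt, functionalExt, h1, ← Abelian.Ext.mk₀_comp_mk₀,
    ← Abelian.Ext.comp_assoc (a₁₂ := 1) (a₂₃ := 0) _ _ _ rfl rfl rfl, h2,
    Abelian.Ext.comp_assoc (a₁₂ := 1) (a₂₃ := 1) _ _ _ rfl rfl rfl]

/-- A `k[t]`-module of functionals on `M`, with `t` acting through `M` and `k` through `K`. -/
structure IsPairing {P : Type*} [AddCommGroup P] [Module k[X] P] (β : P →+ (M.carrier →+ K)) :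
    Prop where
  functional : ∀ x, IsFunctional (β x)
  X_smul : ∀ x m, β ((X : k[X]) • x) m = β x ((X : K[X]) • m)
  C_smul : ∀ (c : k) x m, β ((C c : k[X]) • x) m = algebraMap k K c * β x m

lemma smul_hom_apply {A B : ModuleCat.{u} (SkewRing k K)} (p : k[X]) (f : A ⟶ B) (a : A) :
    (p • f).hom a = SkewRing.ofPoly k K (p.map (algebraMap k K)) • f.hom a := rfl

/-- The `k[t]`-linear map from a module of functionals to `Ext¹`. -/
def pairingExt {P : Type*} [AddCommGroup P] [Module k[X] P] (β : P →+ (M.carrier →+ K))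
    (hβ : IsPairing β) :
    P →ₗ[k[X]] Abelian.Ext.{u} M.toModuleCat (unit k K).toModuleCat 1 :=
  let φ : P →+ Abelian.Ext.{u} M.toModuleCat (unit k K).toModuleCat 1 :=
    AddMonoidHom.mk' (fun x => functionalExt (β x) (hβ.functional x)) (by
      intro x y
      rw [functionalExt, functionalExt, functionalExt, ← Abelian.Ext.comp_add,
        ← Abelian.Ext.mk₀_add]
      congr 2
      apply poly_hom_ext
      intro m
      refine (functionalHom_single_zero _ _ m).trans ?_
      rw [map_add, AddMonoidHom.add_apply, map_add, ← functionalHom_single_zero (β x)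
        (hβ.functional x), ← functionalHom_single_zero (β y) (hβ.functional y)]
      rfl)
  { φ with
    map_smul' := by
      have hsmul : ∀ (p : k[X]) x, p • φ x = M.polyComplex_shortExact.extClass.comp
          (Abelian.Ext.mk₀ (p • functionalHom (β x) (hβ.functional x))) (add_zero 1) := by
        intro p x
        rw [Abelian.Ext.mk₀_smul, Abelian.Ext.comp_smul]
        rfl
      have hC : ∀ (c : k) x, φ ((C c : k[X]) • x) = (C c : k[X]) • φ x := by
        intro c x
        rw [hsmul]
        change functionalExt _ _ = _
        rw [functionalExt]
        congr 2
        apply poly_hom_ext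
        intro m
        rw [smul_hom_apply, functionalHom_single_zero, functionalHom_single_zero, hβ.C_smul,
          map_C, map_mul]
        exact ((unit k K).ofPoly_smul _ _).symm
      have hX : ∀ x, φ ((X : k[X]) • x) = (X : k[X]) • φ x := by
        intro x
        -- Multiplying by `t` on the target and precomposing with `t` on `M` differ by a map that
        -- factors through `T - t`. That term dies against the extension class.
        have h : (X : k[X]) • functionalHom (β x) (hβ.functional x) =
            functionalHom (β ((X : k[X]) • x)) (hβ.functional _) +
              M.polyDiff ≫ functionalHom (β x) (hβ.functional x) := by
          apply poly_hom_ext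
          intro m
          rw [smul_hom_apply, functionalHom_single_zero]
          change _ = (functionalHom _ (hβ.functional _)).hom _ +
            (functionalHom _ (hβ.functional _)).hom (M.polyDiff.hom _)
          rw [polyDiff_single_zero, map_sub, functionalHom_single_zero, functionalHom_single_zero,
            functionalHom_single_one, hβ.X_smul, map_X]
          refine ((unit k K).ofPoly_smul _ _).trans ?_
          change X * C (β x m) = C _ + (X * C (β x m) - C _)
          ring
        rw [hsmul, h, Abelian.Ext.mk₀_add, Abelian.Ext.comp_add, ← Abelian.Ext.mk₀_comp_mk₀,
          ShortComplex.ShortExact.extClass_comp_assoc, add_zero]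
        rfl
      intro p
      change ∀ x, φ (p • x) = p • φ x
      induction p using Polynomial.induction_on with
      | C c => exact hC c
      | add p r hp hr => intro x; rw [add_smul, map_add, hp, hr, add_smul]
      | monomial n c ih => intro x; rw [pow_succ, ← mul_assoc, mul_smul, ih, hX, ← mul_smul] }

end SigmaModule

end ExtClasses

/-! ### Consequences of freeness over `L[σ]` after base change. -/

section GeometricallyFree

variable {k K : Type u} [Field k] [Fintype k] [Field K] [Algebra k K]

namespace SigmaModule

/-- A base change `V` of `M` to a field `L` which is free over `L[σ]`. -/
structure FreeBaseChange (M : SigmaModule k K) (L : Type u) [Field L] [Algebra k L] [Algebra K L]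
    (d : ℕ) where
  V : Type u
  [addCommGroup : AddCommGroup V]
  [module : Module L V]
  σ : V →+ V
  σ_smul : ∀ (c : L) v, σ (c • v) = c ^ Fintype.card k • σ v
  j : M.carrier →+ V
  j_smul : ∀ (c : K) m, j ((C c : K[X]) • m) = algebraMap K L c • j m
  j_sigma : ∀ m, j (M.sigma m) = σ (j m)
  basis : Module.Basis (Fin d × ℕ) L V
  basis_succ : ∀ i n, basis (i, n + 1) = σ (basis (i, n))
  -- Together with `mem_span`, which makes the lift unique, this is the universal property of `V = L
  -- ⊗_K M`.
  exists_lift : ∀ (W : Type u) [AddCommGroup W] [Module L W] (f : M.carrier →+ W),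
    (∀ (c : K) m, f ((C c : K[X]) • m) = algebraMap K L c • f m) →
      ∃ g : V →ₗ[L] W, ∀ m, g (j m) = f m
  mem_span : ∀ v, v ∈ Submodule.span L (Set.range j)

namespace FreeBaseChange

attribute [instance] addCommGroup module

variable {M : SigmaModule k K} {L : Type u} [Field L] [Algebra k L] [Algebra K L] {d : ℕ}
  (F : FreeBaseChange M L d)

include F

/-- Finitely many elements of `M` have `L`-combinations giving the `L[σ]`-generators of `V`. A
`K[σ]`-submodule `N` containing them spans `V` over `L`. A `K`-linear form vanishing on `N` but not
on `M` would extend to a nonzero form on `V` vanishing on this span. -/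
lemma sigmaFinite : M.SigmaFinite := by
  classical
  have h0 : ∀ i, ∃ c : M.carrier →₀ L, (c.sum fun m a => a • F.j m) = F.basis (i, 0) := fun i =>
    Finsupp.mem_span_range_iff_exists_finsupp.mp (F.mem_span _)
  choose c hc using h0
  refine ⟨Finset.univ.biUnion fun i => (c i).support, fun N hNC hNσ hs => ?_⟩
  let : Module K M.carrier := M.scalarModule
  let N' : Submodule K M.carrier := { N with smul_mem' := fun c m hm => hNC c m hm }
  let W := Submodule.span L (F.j '' N)
  have hWσ : ∀ v ∈ W, F.σ v ∈ W := by
    intro v hv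
    induction hv using Submodule.span_induction with
    | mem v hv =>
      obtain ⟨m, hm, rfl⟩ := hv
      rw [← F.j_sigma]
      exact Submodule.subset_span ⟨_, hNσ m hm, rfl⟩
    | zero => rw [map_zero]; exact W.zero_mem
    | add v w _ _ hv hw => rw [map_add]; exact W.add_mem hv hw
    | smul c v _ hv => rw [F.σ_smul]; exact W.smul_mem _ hv
  have hW : W = ⊤ := by
    rw [eq_top_iff, ← F.basis.span_eq, Submodule.span_le]
    rintro _ ⟨⟨i, n⟩, rfl⟩
    induction n with
    | zero =>
      rw [← hc i]
      refine W.sum_mem fun m hm => W.smul_mem _ (Submodule.subset_span ⟨m, hs m ?_, rfl⟩)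
      exact Finset.mem_biUnion.mpr ⟨i, Finset.mem_univ i, hm⟩
    | succ n ih => rw [F.basis_succ]; exact hWσ _ ih
  rw [eq_top_iff]
  intro m _
  by_contra hm
  obtain ⟨f, hfm, hf⟩ := Submodule.exists_le_ker_of_notMem (p := N') (v := m) hm
  obtain ⟨g, hg⟩ := F.exists_lift L ((algebraMap K L).toAddMonoidHom.comp f.toAddMonoidHom)
    (fun c m => by
      change algebraMap K L (f (c • m)) = algebraMap K L c * algebraMap K L (f m)
      rw [map_smul, smul_eq_mul, map_mul])
  have hg0 : W ≤ LinearMap.ker g := by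
    rw [Submodule.span_le]
    rintro _ ⟨n, hn, rfl⟩
    change g _ = 0
    rw [hg]
    change algebraMap K L (f n) = 0
    rw [LinearMap.mem_ker.mp (hf hn), map_zero]
  have h1 : g (F.j m) = 0 := LinearMap.mem_ker.mp (hg0 (by rw [hW]; trivial))
  rw [hg] at h1
  exact hfm ((map_eq_zero (algebraMap K L)).mp h1)

/-- Twisting the `L`-module structure of `L[t]` by the `q`-th power map makes semilinear maps
linear, so that `exists_lift` applies. -/
lemma exists_semilinear_lift (δ : M.carrier →+ L[X])
    (hδ : ∀ (c : K) m, δ ((C c : K[X]) • m) = C (algebraMap K L c ^ Fintype.card k) * δ m) :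
    ∃ g : F.V →+ L[X], (∀ (c : L) v, g (c • v) = C (c ^ Fintype.card k) * g v) ∧
      ∀ m, g (F.j m) = δ m := by
  let inst : Module L L[X] :=
    Module.compHom L[X] ((FiniteField.frobeniusAlgHom k L : L →+* L))
  have hsm : ∀ (c : L) (p : L[X]), inst.smul c p = C (c ^ Fintype.card k) * p :=
    fun c p => (smul_eq_C_mul _)
  obtain ⟨g, hg⟩ := @F.exists_lift L[X] _ inst δ (fun c m => by
    rw [hδ]
    exact (hsm _ _).symm)
  exact ⟨g.toAddMonoidHom, fun c v => (g.map_smul c v).trans (hsm _ _), hg⟩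

/-- On a module free over `L[σ]` the equation `τ h - h σ = g` can be solved along the basis: the
values on the generators are free, and each one determines the value on the next power of `σ`. -/
lemma coboundarySurjective : M.CoboundarySurjective L := by
  intro δ hδ
  obtain ⟨g, hgC, hg⟩ := F.exists_semilinear_lift
    ((Polynomial.mapRingHom (algebraMap K L)).toAddMonoidHom.comp δ) (by
      intro c m
      change (δ _).map (algebraMap K L) = _ * (δ m).map (algebraMap K L)
      rw [hδ, Polynomial.map_mul, map_C, map_pow])
  replace hg : ∀ m, g (F.j m) = (δ m).map (algebraMap K L) := hg
  -- The starting value `0` is arbitrary; the recursion is the equation to be solved, read at `σⁿ`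
  -- of a generator.
  let b : Fin d × ℕ → L[X] := fun x =>
    Nat.rec 0 (fun n p => tau k L p - g (F.basis (x.1, n))) x.2
  have hb : ∀ i n, b (i, n + 1) = tau k L (b (i, n)) - g (F.basis (i, n)) := fun _ _ => rfl
  let h : F.V →ₗ[L] L[X] := F.basis.constr L b
  have hbasis : ∀ x, h (F.basis x) = b x := fun x => F.basis.constr_basis L b x
  have key : ∀ v, tau k L (h v) - h (F.σ v) = g v := by
    intro v
    have hv : v ∈ Submodule.span L (Set.range F.basis) := by rw [F.basis.span_eq]; trivial
    induction hv using Submodule.span_induction with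
    | mem v hv =>
      obtain ⟨⟨i, n⟩, rfl⟩ := hv
      rw [← F.basis_succ, hbasis, hbasis, hb]
      ring
    | zero => simp only [map_zero, sub_zero]
    | add v w _ _ hv hw =>
      simp only [map_add]
      rw [← hv, ← hw]
      ring
    | smul c v _ hv =>
      rw [hgC, F.σ_smul, h.map_smul, h.map_smul, ← hv, smul_eq_C_mul, smul_eq_C_mul, map_mul,
        tau_C]
      ring
  refine ⟨h.toAddMonoidHom.comp F.j, fun c m => ?_, fun m => ?_⟩
  · change h _ = _ * h _
    rw [F.j_smul, h.map_smul, smul_eq_C_mul]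
  · change tau k L (h _) - h _ = _
    rw [F.j_sigma, key, hg]

lemma exists_functional_lift (x : M.carrier →+ K) (hx : IsFunctional x) :
    ∃ g : F.V →ₗ[L] L, (∀ m, g (F.j m) = algebraMap K L (x m)) ∧
      ∀ v, g (F.σ v) = g v ^ Fintype.card k := by
  obtain ⟨g, hg⟩ := F.exists_lift L ((algebraMap K L).toAddMonoidHom.comp x) (fun c m => by
    change algebraMap K L (x _) = algebraMap K L c * algebraMap K L (x m)
    rw [hx.smul, Algebra.algebraMap_self_apply, map_mul])
  replace hg : ∀ m, g (F.j m) = algebraMap K L (x m) := hg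
  refine ⟨g, hg, fun v => ?_⟩
  have hv := F.mem_span v
  induction hv using Submodule.span_induction with
  | mem v hv =>
    obtain ⟨m, rfl⟩ := hv
    rw [← F.j_sigma, hg, hg, hx.sigma, map_pow]
  | zero => rw [map_zero, map_zero, zero_pow Fintype.card_ne_zero]
  | add v w _ _ hv hw =>
    rw [map_add, map_add, map_add, hv, hw]
    exact (map_add (FiniteField.frobeniusAlgHom k L) _ _).symm
  | smul c v _ hv => rw [F.σ_smul, map_smul, map_smul, hv, smul_eq_mul, smul_eq_mul, mul_pow]

end FreeBaseChange

end SigmaModule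

end GeometricallyFree

/-! ### Additive polynomials are combinations of `q ^ n`-th powers of the variables. -/

section AdditivePolynomials

variable {k L : Type u} [Field k] [Fintype k] [Field L] [Algebra k L]

/-- If `c ^ m = c` on a finite field with `q` elements and all the inner binomial coefficients
`m.choose j` vanish in characteristic `p`, then `m` is a power of `q`. -/
lemma exists_eq_card_pow {m : ℕ} (hm : m ≠ 0) (hc : ∀ c : k, c ^ m = c)
    (hch : ∀ j, 0 < j → j < m → (m.choose j : L) = 0) : ∃ n, m = Fintype.card k ^ n := by
  obtain ⟨p, hp⟩ := CharP.exists k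
  obtain ⟨e, hpp, hcard⟩ := FiniteField.card k p
  have : Fact p.Prime := ⟨hpp⟩
  have : CharP L p := charP_of_injective_algebraMap (algebraMap k L).injective p
  obtain ⟨a, r, hr, rfl⟩ := Nat.exists_eq_pow_mul_and_not_dvd hm p hpp.ne_one
  have hr1 : r = 1 := by
    by_contra hne
    have hr0 : r ≠ 0 := fun h => hr (h ▸ dvd_zero p)
    have hlt : p ^ a < p ^ a * r :=
      lt_mul_of_one_lt_right (pow_pos hpp.pos a) (by omega)
    have h0 := hch (p ^ a) (pow_pos hpp.pos a) hlt
    -- In characteristic `p`, `(1 + X) ^ (p ^ a * r) = (1 + X ^ p ^ a) ^ r`, whose coefficient in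
    -- degree `p ^ a` is `r`. If `r ≠ 1`, it would have to vanish although `p ∤ r`.
    rw [← Polynomial.coeff_one_add_X_pow, pow_mul, add_pow_char_pow, one_pow] at h0
    have h1 : ((1 : L[X]) + X ^ p ^ a) ^ r = expand L (p ^ a) ((1 + X) ^ r) := by simp
    have h2 := coeff_expand_mul (pow_pos hpp.pos a) ((1 + X : L[X]) ^ r) 1
    rw [one_mul, ← h1, h0, coeff_one_add_X_pow, Nat.choose_one_right] at h2
    exact hr ((CharP.cast_eq_zero_iff L p r).mp h2.symm)
  subst hr1
  rw [mul_one] at hc ⊢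
  -- With `q = p ^ e`, divisibility of `p ^ a - 1` by `p ^ e - 1` forces `e ∣ a`, through the gcd of
  -- these two numbers.
  have hdvd : Fintype.card k - 1 ∣ p ^ a - 1 := by
    rw [← FiniteField.forall_pow_eq_one_iff k]
    intro x
    have h1 := hc x
    have h2 : x ^ (p ^ a) = x := Units.ext (by rw [Units.val_pow_eq_pow_val, h1])
    have h3 : x ^ (p ^ a - 1) * x = 1 * x := by
      rw [← pow_succ, Nat.sub_add_cancel (Nat.one_le_pow _ _ hpp.pos), h2, one_mul]
    exact mul_right_cancel h3
  rw [hcard] at hdvd ⊢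
  have hg := Nat.pow_sub_one_gcd_pow_sub_one p e a
  rw [Nat.gcd_eq_left hdvd] at hg
  have h4 : p ^ (e : ℕ) = p ^ Nat.gcd e a := by
    have h5 := Nat.one_le_pow (e : ℕ) p hpp.pos
    have h6 := Nat.one_le_pow (Nat.gcd e a) p hpp.pos
    omega
  have h7 : (e : ℕ) ∣ a := by
    rw [Nat.pow_right_injective hpp.two_le h4]
    exact Nat.gcd_dvd_right _ _
  obtain ⟨n, rfl⟩ := h7
  exact ⟨n, pow_mul _ _ _⟩

/-- If the coefficient in degree `m` is nonzero, `k`-linearity at the universal point gives `c ^ m =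
c` on `k`. Additivity at two independent variables makes the Hasse derivatives constant, so the
inner binomial coefficients of `m` vanish in `L`. Then `exists_eq_card_pow` applies. -/
lemma coeff_eq_zero_of_additive (G : L[X])
    (hadd : ∀ (R : Type u) [CommRing R] [Algebra L R] (u v : R),
      aeval (u + v) G = aeval u G + aeval v G)
    (hsmul : ∀ (R : Type u) [CommRing R] [Algebra L R] (c : k) (u : R),
      aeval (algebraMap L R (algebraMap k L c) * u) G =
        algebraMap L R (algebraMap k L c) * aeval u G)
    (m : ℕ) (hm : ∀ n, m ≠ Fintype.card k ^ n) : G.coeff m = 0 := by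
  by_contra hne
  have hcoeff : ∀ c : k, c ^ m = c := by
    intro c
    have h := congrArg (fun p : L[X] => p.coeff m) (hsmul L[X] c X)
    simp only [aeval_X_left_apply, algebraMap_eq, coeff_C_mul] at h
    have h2 : aeval (C (algebraMap k L c) * X) G = G.comp (C (algebraMap k L c) * X) := rfl
    rw [h2, comp_C_mul_X_coeff, mul_comm] at h
    have h3 := mul_right_cancel₀ hne h
    rw [← map_pow] at h3
    exact (algebraMap k L).injective h3
  have hm0 : m ≠ 0 := by
    rintro rfl
    have := hcoeff 0
    rw [pow_zero] at this
    exact one_ne_zero this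
  have hderiv : ∀ j, 0 < j → hasseDeriv j G = C (G.coeff j) := by
    intro j hj
    -- The outer `X` and the inner `C X` are the two independent variables; the coefficient of
    -- degree `j` in the outer one is the `j`-th Hasse derivative in the inner one.
    have h := congrArg (fun p : L[X][X] => p.coeff j) (hadd L[X][X] X (C X))
    simp only [coeff_add] at h
    have e1 : aeval (X + C X : L[X][X]) G = taylor X (G.map C) := by
      rw [taylor_apply, comp, eval₂_map]
      rfl
    have e2 : aeval (X : L[X][X]) G = G.map C := rfl
    have e3 : aeval (C X : L[X][X]) G = C G := by
      have := aeval_algebraMap_apply L[X][X] (X : L[X]) G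
      rwa [aeval_X_left_apply] at this
    have e4 : hasseDeriv j (G.map C) = (hasseDeriv j G).map (C : L →+* L[X]) := by
      ext1 n
      rw [hasseDeriv_coeff, coeff_map, coeff_map, hasseDeriv_coeff, map_mul, map_natCast]
    rw [e1, e2, e3, taylor_coeff, coeff_C_of_ne_zero hj.ne', add_zero, coeff_map] at h
    rw [← h, e4, Polynomial.eval_map, eval₂_C_X]
  obtain ⟨n, hn⟩ := exists_eq_card_pow (L := L) hm0 hcoeff (by
    intro j hj hjm
    have h := congrArg (fun p : L[X] => p.coeff (m - j)) (hderiv j hj)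
    simp only [hasseDeriv_coeff] at h
    rw [coeff_C_of_ne_zero (by omega), Nat.sub_add_cancel hjm.le] at h
    exact (mul_eq_zero.mp h).resolve_right hne)
  exact hm n hn

lemma mem_span_of_additive {d : ℕ} (F : MvPolynomial (Fin d) L)
    (hadd : ∀ (R : Type u) [CommRing R] [Algebra L R] (u v : Fin d → R),
      MvPolynomial.aeval (u + v) F = MvPolynomial.aeval u F + MvPolynomial.aeval v F)
    (hsmul : ∀ (R : Type u) [CommRing R] [Algebra L R] (c : k) (u : Fin d → R),
      MvPolynomial.aeval (fun i => algebraMap L R (algebraMap k L c) * u i) F =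
        algebraMap L R (algebraMap k L c) * MvPolynomial.aeval u F) :
    F ∈ Submodule.span L (Set.range fun x : Fin d × ℕ =>
      (MvPolynomial.X x.1 ^ Fintype.card k ^ x.2 : MvPolynomial (Fin d) L)) := by
  classical
  -- `G i` is the restriction of `F` to the `i`-th axis. By additivity `F` is the sum of the `G i`,
  -- which reduces the claim to one variable.
  let G : Fin d → L[X] := fun i => MvPolynomial.aeval (Pi.single i X) F
  have hG : ∀ (R : Type u) [CommRing R] [Algebra L R] i (u : R),
      aeval u (G i) = MvPolynomial.aeval (Pi.single i u) F := by
    intro R _ _ i u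
    change (aeval u) (MvPolynomial.aeval (Pi.single i X) F) = _
    rw [← AlgHom.comp_apply]
    congr 1
    ext j
    rcases eq_or_ne j i with rfl | h
    · simp
    · simp [h]
  have hcoeff : ∀ i m, (∀ n, m ≠ Fintype.card k ^ n) → (G i).coeff m = 0 := by
    intro i
    refine coeff_eq_zero_of_additive (k := k) (G i) (fun R _ _ u v => ?_) (fun R _ _ c u => ?_)
    · rw [hG, hG, hG, ← hadd, ← Pi.single_add]
    · rw [hG, hG, ← hsmul]
      congr 2
      ext j
      rcases eq_or_ne j i with rfl | h
      · simp
      · simp [h]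
  have hsum : F = ∑ i, aeval (MvPolynomial.X i : MvPolynomial (Fin d) L) (G i) := by
    let A : (Fin d → MvPolynomial (Fin d) L) →+ MvPolynomial (Fin d) L :=
      AddMonoidHom.mk' (fun u => MvPolynomial.aeval u F) (hadd _)
    have h1 : F = A MvPolynomial.X := (MvPolynomial.aeval_X_left_apply F).symm
    have h2 : (MvPolynomial.X : Fin d → MvPolynomial (Fin d) L) =
        ∑ i, Pi.single i (MvPolynomial.X i) := (Finset.univ_sum_single _).symm
    conv_lhs => rw [h1, h2, map_sum]
    exact Finset.sum_congr rfl fun i _ => (hG _ i _).symm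
  rw [hsum]
  refine Submodule.sum_mem _ fun i _ => ?_
  rw [aeval_eq_sum_range]
  refine Submodule.sum_mem _ fun m _ => ?_
  by_cases hm : ∃ n, m = Fintype.card k ^ n
  · obtain ⟨n, rfl⟩ := hm
    exact Submodule.smul_mem _ _ (Submodule.subset_span ⟨(i, n), rfl⟩)
  · rw [hcoeff i m (fun n hn => hm ⟨n, hn⟩), zero_smul]
    exact Submodule.zero_mem _

omit [Algebra k L] in
lemma linearIndependent_X_pow (d : ℕ) :
    LinearIndependent L fun x : Fin d × ℕ =>
      (MvPolynomial.X x.1 ^ Fintype.card k ^ x.2 : MvPolynomial (Fin d) L) := by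
  have h := (MvPolynomial.basisMonomials (Fin d) L).linearIndependent
  have hinj : Function.Injective fun x : Fin d × ℕ => Finsupp.single x.1 (Fintype.card k ^ x.2) := by
    rintro ⟨i, n⟩ ⟨j, m⟩ hij
    have hpos : ∀ n, Fintype.card k ^ n ≠ 0 := fun n => pow_ne_zero n Fintype.card_ne_zero
    rcases (Finsupp.single_eq_single_iff _ _ _ _).mp hij with ⟨rfl, h⟩ | ⟨h, _⟩
    · simp only at h
      rw [Nat.pow_right_injective Fintype.one_lt_card h]
    · exact absurd h (hpos n)
  have e : (fun x : Fin d × ℕ =>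
      (MvPolynomial.X x.1 ^ Fintype.card k ^ x.2 : MvPolynomial (Fin d) L)) =
      MvPolynomial.basisMonomials (Fin d) L ∘
        fun x : Fin d × ℕ => Finsupp.single x.1 (Fintype.card k ^ x.2) := by
    funext x
    rw [Function.comp_apply, MvPolynomial.coe_basisMonomials, MvPolynomial.X_pow_eq_monomial]
  rw [e]
  exact h.comp _ hinj

end AdditivePolynomials

/-! ### Coordinates on `B = L ⊗_K A` for a basis of `L` over `K`. -/

section Pushout

variable {K L A B : Type u} [Field K] [Field L] [Algebra K L] [CommRing A] [CommRing B]
  {s : K →+* A} {p : A →+* B} {s' : L →+* B}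

lemma isBaseChange_of_isPushout
    (h : IsPushout (CommRingCat.ofHom s) (CommRingCat.ofHom (algebraMap K L))
      (CommRingCat.ofHom p) (CommRingCat.ofHom s')) :
    letI := s.toAlgebra
    letI := p.toAlgebra
    letI := s'.toAlgebra
    letI := (s'.comp (algebraMap K L)).toAlgebra
    haveI : IsScalarTower K L B := .of_algebraMap_eq' rfl
    haveI : IsScalarTower K A B := .of_algebraMap_eq' (congrArg CommRingCat.Hom.hom h.w).symm
    Algebra.IsPushout K A L B := by
  let := s.toAlgebra
  let := p.toAlgebra
  let := s'.toAlgebra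
  let := (s'.comp (algebraMap K L)).toAlgebra
  have : IsScalarTower K L B := .of_algebraMap_eq' rfl
  have : IsScalarTower K A B := .of_algebraMap_eq' (congrArg CommRingCat.Hom.hom h.w).symm
  exact CommRingCat.isPushout_iff_isPushout.mp h

/-- In a pushout `B = L ⊗ A` a basis of `L` over `K` gives a basis of `B` over `A`. -/
def pushoutBasis
    (h : IsPushout (CommRingCat.ofHom s) (CommRingCat.ofHom (algebraMap K L))
      (CommRingCat.ofHom p) (CommRingCat.ofHom s')) {ι : Type*} (b : Module.Basis ι K L) :
    letI := p.toAlgebra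
    Module.Basis ι A B :=
  letI := s.toAlgebra
  letI := p.toAlgebra
  letI := s'.toAlgebra
  letI := (s'.comp (algebraMap K L)).toAlgebra
  haveI : IsScalarTower K L B := .of_algebraMap_eq' rfl
  haveI : IsScalarTower K A B := .of_algebraMap_eq' (congrArg CommRingCat.Hom.hom h.w).symm
  (isBaseChange_of_isPushout h).out.basis b

lemma pushoutBasis_apply
    (h : IsPushout (CommRingCat.ofHom s) (CommRingCat.ofHom (algebraMap K L))
      (CommRingCat.ofHom p) (CommRingCat.ofHom s')) {ι : Type*} (b : Module.Basis ι K L) (i : ι) :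
    letI := p.toAlgebra
    pushoutBasis h b i = s' (b i) := by
  let := s.toAlgebra
  let := p.toAlgebra
  let := s'.toAlgebra
  let := (s'.comp (algebraMap K L)).toAlgebra
  have : IsScalarTower K L B := .of_algebraMap_eq' rfl
  have : IsScalarTower K A B := .of_algebraMap_eq' (congrArg CommRingCat.Hom.hom h.w).symm
  exact IsBaseChange.basis_apply _ _ _

/-- The coordinate `B → A` of the elements of a pushout `B = L ⊗ A` for a basis of `L`. -/
def pushoutCoord
    (h : IsPushout (CommRingCat.ofHom s) (CommRingCat.ofHom (algebraMap K L))
      (CommRingCat.ofHom p) (CommRingCat.ofHom s')) {ι : Type*} (b : Module.Basis ι K L) (i : ι) :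
    B →+ A :=
  letI := p.toAlgebra
  ((pushoutBasis h b).coord i).toAddMonoidHom

section

variable (h : IsPushout (CommRingCat.ofHom s) (CommRingCat.ofHom (algebraMap K L))
  (CommRingCat.ofHom p) (CommRingCat.ofHom s')) {ι : Type*} (b : Module.Basis ι K L)

lemma pushoutCoord_mul (i : ι) (x : A) (y : B) :
    pushoutCoord h b i (p x * y) = x * pushoutCoord h b i y := by
  let := p.toAlgebra
  exact ((pushoutBasis h b).coord i).map_smul x y

lemma pushoutCoord_basis [DecidableEq ι] (i j : ι) :
    pushoutCoord h b i (s' (b j)) = if j = i then 1 else 0 := by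
  let := p.toAlgebra
  change (pushoutBasis h b).coord i _ = _
  rw [← pushoutBasis_apply h b j, Module.Basis.coord_apply, Module.Basis.repr_self,
    Finsupp.single_apply]

lemma pushout_eq_sum (y : B) :
    ∃ t : Finset ι, y = ∑ i ∈ t, p (pushoutCoord h b i y) * s' (b i) := by
  let := p.toAlgebra
  refine ⟨((pushoutBasis h b).repr y).support, ?_⟩
  conv_lhs => rw [← (pushoutBasis h b).linearCombination_repr y, Finsupp.linearCombination_apply,
    Finsupp.sum]
  refine Finset.sum_congr rfl fun i _ => ?_
  rw [pushoutBasis_apply h b i]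
  rfl

end

/-- Both sides are additive in `y`, so the comparison reduces to products `p a * s' (b j)`. This
naturality is what makes the coordinates of an additive function additive. -/
lemma pushoutCoord_naturality {A₁ B₁ : Type u} [CommRing A₁] [CommRing B₁]
    {s₁ : K →+* A₁} {p₁ : A₁ →+* B₁} {s₁' : L →+* B₁}
    (h : IsPushout (CommRingCat.ofHom s) (CommRingCat.ofHom (algebraMap K L))
      (CommRingCat.ofHom p) (CommRingCat.ofHom s'))
    (h₁ : IsPushout (CommRingCat.ofHom s₁) (CommRingCat.ofHom (algebraMap K L))
      (CommRingCat.ofHom p₁) (CommRingCat.ofHom s₁')) {ι : Type*} (b : Module.Basis ι K L)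
    (φ : A →+* A₁) (ψ : B →+* B₁) (hp : ∀ a, ψ (p a) = p₁ (φ a)) (hs : ∀ c, ψ (s' c) = s₁' c)
    (i : ι) (y : B) : pushoutCoord h₁ b i (ψ y) = φ (pushoutCoord h b i y) := by
  classical
  obtain ⟨t, ht⟩ := pushout_eq_sum h b y
  have key : ∀ (c : ι → A), pushoutCoord h₁ b i (ψ (∑ j ∈ t, p (c j) * s' (b j))) =
      φ (pushoutCoord h b i (∑ j ∈ t, p (c j) * s' (b j))) := by
    intro c
    rw [map_sum, map_sum, map_sum, map_sum]
    refine Finset.sum_congr rfl fun j _ => ?_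
    rw [map_mul, hp, hs, pushoutCoord_mul, pushoutCoord_mul, pushoutCoord_basis,
      pushoutCoord_basis, map_mul]
    split_ifs <;> simp
  rw [ht]
  exact key _

lemma exists_lift_of_isPushout
    (h : IsPushout (CommRingCat.ofHom s) (CommRingCat.ofHom (algebraMap K L))
      (CommRingCat.ofHom p) (CommRingCat.ofHom s')) (W : Type u) [AddCommGroup W] [Module L W]
    (f : A →+ W) (hf : ∀ (c : K) a, f (s c * a) = algebraMap K L c • f a) :
    ∃ g : B →+ W, (∀ (c : L) b, g (s' c * b) = c • g b) ∧ ∀ a, g (p a) = f a := by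
  let := s.toAlgebra
  let := p.toAlgebra
  let := s'.toAlgebra
  let := (s'.comp (algebraMap K L)).toAlgebra
  have : IsScalarTower K L B := .of_algebraMap_eq' rfl
  have : IsScalarTower K A B := .of_algebraMap_eq' (congrArg CommRingCat.Hom.hom h.w).symm
  let : Module K W := Module.compHom W (algebraMap K L)
  have : IsScalarTower K L W := .of_algebraMap_smul fun _ _ => rfl
  have h' := (isBaseChange_of_isPushout h).symm.out
  let f' : A →ₗ[K] W := { f with map_smul' := hf }
  exact ⟨(h'.lift f').toAddMonoidHom, fun c b => (h'.lift f').map_smul c b, fun a => h'.lift_eq f' a⟩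

end Pushout

namespace ModuleScheme

/-! ### Flat base change of global functions and descent of affineness. -/

section BaseChange

variable (K L : Type u) [Field K] [Field L] [Algebra K L]

/-- The base change of a `K`-scheme to `L`. -/
abbrev extend (X : Over (Spec (CommRingCat.of K))) : Over (Spec (CommRingCat.of L)) :=
  (Over.pullback (specMap K L)).obj X

variable {K}

/-- The projection from the base change of a `K`-scheme. -/
def extendProj (X : Over (Spec (CommRingCat.of K))) :
    (Over.map (specMap K L)).obj (extend K L X) ⟶ X :=
  (Over.mapPullbackAdj (specMap K L)).counit.app X

lemma isPullback_extendProj (X : Over (Spec (CommRingCat.of K))) :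
    IsPullback (extendProj L X).left (extend K L X).hom X.hom (specMap K L) := by
  have : (extendProj L X).left = Limits.pullback.fst X.hom (specMap K L) := by
    simp [extendProj]
  rw [this]
  exact IsPullback.of_hasPullback _ _

lemma flat_and_surjective_specMap : Flat (specMap K L) ∧ Surjective (specMap K L) :=
  flat_and_surjective_SpecMap_iff _ |>.mpr
    ((RingHom.faithfullyFlat_algebraMap_iff (R := K) (S := L)).mpr inferInstance)

instance : Flat (specMap K L) := (flat_and_surjective_specMap L).1

instance : Surjective (specMap K L) := (flat_and_surjective_specMap L).2

/-- Flat base change for global functions, with `X` quasi-compact and quasi-separated and both bases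
affine. -/
lemma isPushout_appTop {X Y S T : Scheme.{u}} {g : Y ⟶ X} {y : Y ⟶ T} {x : X ⟶ S} {f : T ⟶ S}
    (h : IsPullback g y x f) [CompactSpace X] [QuasiSeparatedSpace X] [IsAffine S] [IsAffine T]
    [Flat f] : IsPushout x.appTop f.appTop g.appTop y.appTop := by
  have h1 := isIso_pushoutSection_of_isQuasiSeparated_of_flat_right
    h (US := ⊤) (UT := ⊤) (UX := ⊤) (UY := ⊤) (by simp) (by simp) (by simp)
    (isAffineOpen_top _) (isAffineOpen_top _) isCompact_univ
    (by simpa using! isQuasiSeparated_univ)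
  have ht : ∀ {X Y : Scheme.{u}} (f : X ⟶ Y), (⊤ : X.Opens) ≤ f ⁻¹ᵁ ⊤ := fun f => le_refl _
  have e : ∀ {X Y : Scheme.{u}} (f : X ⟶ Y), f.appLE ⊤ ⊤ (ht f) = f.appTop :=
    fun f => f.appLE_eq_app
  have h2 : IsPushout (x.appLE ⊤ ⊤ (ht x)) (f.appLE ⊤ ⊤ (ht f)) (g.appLE ⊤ ⊤ (ht g))
    (y.appLE ⊤ ⊤ (ht y)) := (isIso_pushoutSection_iff ..).mp h1
  rwa [e, e, e, e] at h2

lemma isPushout_scalar (X : Over (Spec (CommRingCat.of K))) [CompactSpace X.left]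
    [QuasiSeparatedSpace X.left] :
    IsPushout (CommRingCat.ofHom (scalar X)) (CommRingCat.ofHom (algebraMap K L))
      (CommRingCat.ofHom (R := Γ(X.left, ⊤)) (S := Γ((extend K L X).left, ⊤))
        (pull (extendProj L X)))
      (CommRingCat.ofHom (scalar (extend K L X))) := by
  refine (isPushout_appTop (isPullback_extendProj L X)).of_iso (Scheme.ΓSpecIso _) (Iso.refl _)
    (Scheme.ΓSpecIso _) (Iso.refl _) ?_ ?_ ?_ ?_
  · simp [scalar]
  · exact Scheme.ΓSpecIso_naturality _
  · exact (Category.id_comp _).trans (Category.comp_id _).symm |>.symm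
  · simp [scalar]

lemma pull_extendProj_scalar (X : Over (Spec (CommRingCat.of K))) (c : K) :
    pull (extendProj L X) (scalar X c) = scalar (extend K L X) (algebraMap K L c) := by
  rw [pull_scalar]
  exact scalar_map _ _

end BaseChange

lemma quasiSeparatedSpace_of_surjective {X Y : Scheme.{u}} (f : X ⟶ Y) [Surjective f]
    [QuasiCompact f] [QuasiSeparatedSpace X] : QuasiSeparatedSpace Y := by
  refine ⟨fun U V hU hU' hV hV' => ?_⟩
  have h : IsCompact (f ⁻¹' U ∩ f ⁻¹' V) :=
    QuasiSeparatedSpace.inter_isCompact _ _ (hU.preimage f.continuous)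
      (QuasiCompact.isCompact_preimage U hU hU') (hV.preimage f.continuous)
      (QuasiCompact.isCompact_preimage V hV hV')
  rw [← Set.preimage_inter] at h
  rw [← Set.image_preimage_eq (U ∩ V : Set Y) f.surjective]
  exact h.image f.continuous

/-- A scheme whose pull-back along a flat surjective morphism of affine schemes is affine is
affine. -/
lemma isAffine_of_isPullback {X Y S T : Scheme.{u}} {g : Y ⟶ X} {y : Y ⟶ T} {x : X ⟶ S} {f : T ⟶ S}
    (h : IsPullback g y x f) [IsAffine S] [IsAffine T] [Flat f] [Surjective f] [IsAffine Y] :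
    IsAffine X := by
  have hg : IsAffineHom g := MorphismProperty.of_isPullback h.flip inferInstance
  have hgs : Surjective g := MorphismProperty.of_isPullback h.flip inferInstance
  have hgf : Flat g := MorphismProperty.of_isPullback h.flip inferInstance
  have : CompactSpace X := ⟨by
    rw [← Set.image_univ_of_surjective g.surjective]
    exact isCompact_univ.image g.continuous⟩
  have : QuasiSeparatedSpace X := quasiSeparatedSpace_of_surjective g
  have hp : IsPullback (Spec.map g.appTop) (Spec.map y.appTop) (Spec.map x.appTop)
      (Spec.map f.appTop) := ((isPushout_appTop h).op.map Scheme.Spec).flip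
  have ho : IsPullback g (Y.toSpecΓ ≫ Spec.map y.appTop) (X.toSpecΓ ≫ Spec.map x.appTop)
      (Spec.map f.appTop) := by
    rw [← Scheme.toSpecΓ_naturality, ← Scheme.toSpecΓ_naturality]
    exact h.paste_vert (IsPullback.of_vert_isIso ⟨Scheme.toSpecΓ_naturality f⟩)
  -- By cancelling squares, `Y → Spec Γ(Y)` is the base change of `X → Spec Γ(X)` along a faithfully
  -- flat morphism. It is an isomorphism as `Y` is affine, and being an isomorphism descends.
  have sq : IsPullback g Y.toSpecΓ X.toSpecΓ (Spec.map g.appTop) :=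
    IsPullback.of_bot ho (Scheme.toSpecΓ_naturality g) hp
  obtain ⟨hl, hs⟩ := (flat_and_surjective_SpecMap_iff f.appTop).mpr
    ((Flat.flat_and_surjective_iff_faithfullyFlat_of_isAffine f).mp ⟨inferInstance, inferInstance⟩)
  have hf' : (@Surjective ⊓ @Flat ⊓ @QuasiCompact : MorphismProperty Scheme.{u})
      (Spec.map g.appTop) :=
    ⟨⟨MorphismProperty.of_isPullback hp.flip hs, MorphismProperty.of_isPullback hp.flip hl⟩,
      inferInstance⟩
  have hiso : MorphismProperty.isomorphisms Scheme.{u} Y.toSpecΓ :=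
    (inferInstance : IsIso Y.toSpecΓ)
  exact ⟨MorphismProperty.of_isPullback_of_descendsAlong sq.flip hf' hiso⟩

/-! ### Morphisms to affine schemes are ring homomorphisms. -/

section AffineTarget

variable {K : Type u} [Field K]

lemma hom_ext_of_isAffine {T X : Over (Spec (CommRingCat.of K))} [IsAffine X.left] {x y : T ⟶ X}
    (h : ∀ f, pull x f = pull y f) : x = y := by
  apply Over.OverMorphism.ext
  apply ext_of_isAffine
  ext f
  exact h f

lemma exists_hom_of_isAffine {T X : Over (Spec (CommRingCat.of K))} [IsAffine X.left]
    (φ : Γ(X.left, ⊤) →+* Γ(T.left, ⊤)) (hφ : ∀ c, φ (scalar X c) = scalar T c) :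
    ∃ x : T ⟶ X, ∀ f, pull x f = φ f := by
  obtain ⟨x, h⟩ : ∃ x : T.left ⟶ X.left,
      x ≫ X.left.toSpecΓ = T.left.toSpecΓ ≫ Spec.map (CommRingCat.ofHom φ) := by
    refine ⟨T.left.toSpecΓ ≫ Spec.map (CommRingCat.ofHom φ) ≫ X.left.isoSpec.inv, ?_⟩
    rw [Category.assoc, Category.assoc, Scheme.isoSpec_inv_toSpecΓ]
    exact congrArg _ (Category.comp_id _)
  have hx : x.appTop = CommRingCat.ofHom φ := by
    have h' := congrArg Scheme.Hom.appTop h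
    rw [Scheme.Hom.comp_appTop x, Scheme.Hom.comp_appTop T.left.toSpecΓ, Scheme.toSpecΓ_appTop,
      Scheme.toSpecΓ_appTop, Scheme.ΓSpecIso_naturality] at h'
    exact (cancel_epi _).mp h'
  refine ⟨Over.homMk x ?_, fun f => ?_⟩
  · apply ext_of_isAffine
    rw [Scheme.Hom.comp_appTop, hx, ← cancel_epi (Scheme.ΓSpecIso (CommRingCat.of K)).inv]
    ext c
    exact hφ c
  · change x.appTop.hom f = _
    rw [hx]
    rfl

variable {R : Type u} [CommRing R] [Algebra K R]

instance : IsAffine (specOver K R).left := inferInstanceAs (IsAffine (Spec _))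

variable (K R) in
/-- The functions on `Spec R`. -/
def specSections : R ≃+* Γ((specOver K R).left, ⊤) :=
  (Scheme.ΓSpecIso (CommRingCat.of R)).symm.commRingCatIsoToRingEquiv

lemma specSections_algebraMap (c : K) :
    specSections K R (algebraMap K R c) = scalar (specOver K R) c := by
  have := Scheme.ΓSpecIso_inv_naturality (CommRingCat.ofHom (algebraMap K R))
  exact congrArg (fun f => f.hom c) this

lemma exists_hom_specOver {X : Over (Spec (CommRingCat.of K))} [IsAffine X.left]
    (φ : Γ(X.left, ⊤) →+* R) (hφ : ∀ c, φ (scalar X c) = algebraMap K R c) :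
    ∃ x : specOver K R ⟶ X, ∀ f, pull x f = specSections K R (φ f) :=
  exists_hom_of_isAffine ((specSections K R : R →+* Γ((specOver K R).left, ⊤)).comp φ) fun c => by
    rw [← specSections_algebraMap, ← hφ]
    rfl

end AffineTarget

/-! ### Coordinates on a scheme isomorphic to a power of `𝔾ₐ`. -/

section Coordinates

variable {k L : Type u} [Field k] [Field L] [Algebra k L]
  {E : ModuleScheme k[X] (Spec (CommRingCat.of L))} {d : ℕ}

/-- Additive functions which identify `E` with affine space. -/
def IsCoordinates (ξ : Fin d → E.GaHom) : Prop :=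
  ∀ T : Over (Spec (CommRingCat.of L)),
    Function.Bijective fun (x : T ⟶ E.toOver) (i : Fin d) => pull x (ξ i).1

/-- By Yoneda, the coordinates are the components of the universal point `𝟙 E`. -/
lemma IsoGaPow.exists_isCoordinates (h : E.IsoGaPow d) :
    ∃ ξ : Fin d → E.GaHom, IsCoordinates ξ := by
  obtain ⟨e, he, hs⟩ := h
  have hp : ∀ T (x : T ⟶ E.toOver) i, pull x (e _ (𝟙 E.toOver) i) = e T x i := by
    intro T x i
    rw [← he, Category.comp_id]
  refine ⟨fun i => ⟨e _ (𝟙 E.toOver) i, fun T x y => ⟨?_, fun c => ?_⟩⟩, fun T => ?_⟩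
  · rw [hp, hp, hp, map_add, Pi.add_apply]
  · rw [hp, hp, hs]
  · have : (fun (x : T ⟶ E.toOver) (i : Fin d) => pull x (e _ (𝟙 E.toOver) i)) = e T := by
      funext x i
      exact hp T x i
    change Function.Bijective fun (x : T ⟶ E.toOver) (i : Fin d) => pull x (e _ (𝟙 E.toOver) i)
    rw [this]
    exact (e T).bijective

variable {ξ : Fin d → E.GaHom}

/-- The ring homomorphism from polynomials to functions given by coordinates. -/
def coordinateHom (ξ : Fin d → E.GaHom) : MvPolynomial (Fin d) L →+* Γ(E.toOver.left, ⊤) :=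
  MvPolynomial.eval₂Hom (scalar E.toOver) fun i => (ξ i).1

/-- `E` and affine space represent the same functor. The inverse morphism comes from surjectivity of
the coordinates at affine space itself, and injectivity on points identifies one of the composites.
-/
lemma IsCoordinates.isAffine_and_bijective (hξ : IsCoordinates ξ) :
    IsAffine E.toOver.left ∧ Function.Bijective (coordinateHom ξ) := by
  let A := specOver L (MvPolynomial (Fin d) L)
  let s := specSections L (MvPolynomial (Fin d) L)
  obtain ⟨a, ha⟩ := exists_hom_of_isAffine (T := E.toOver) (X := A)
    ((coordinateHom ξ).comp (s.symm : _ →+* MvPolynomial (Fin d) L)) (fun c => by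
      rw [← specSections_algebraMap, RingHom.comp_apply, RingHom.coe_coe, RingEquiv.symm_apply_apply]
      exact MvPolynomial.eval₂Hom_C _ _ _)
  have ha' : ∀ p, pull a (s p) = coordinateHom ξ p := fun p => by
    rw [ha, RingHom.comp_apply, RingHom.coe_coe, RingEquiv.symm_apply_apply]
  obtain ⟨b, hb⟩ := (hξ A).2 fun i => s (MvPolynomial.X i)
  have hb' : ∀ i, pull b (ξ i).1 = s (MvPolynomial.X i) := congrFun hb
  have hab : a ≫ b = 𝟙 _ := by
    apply (hξ _).1
    funext i
    change pull (a ≫ b) _ = pull (𝟙 _) _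
    rw [pull_comp, hb', ha', coordinateHom, MvPolynomial.eval₂Hom_X']
    rfl
  have hc : ((pull b).comp (coordinateHom ξ)) = (s : MvPolynomial (Fin d) L →+* _) := by
    apply MvPolynomial.ringHom_ext
    · intro c
      rw [RingHom.comp_apply, coordinateHom, MvPolynomial.eval₂Hom_C, pull_scalar]
      exact (specSections_algebraMap c).symm
    · intro i
      rw [RingHom.comp_apply, coordinateHom, MvPolynomial.eval₂Hom_X', hb']
      rfl
  have hba : b ≫ a = 𝟙 _ := by
    apply hom_ext_of_isAffine
    intro f
    obtain ⟨p, rfl⟩ := s.surjective f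
    rw [pull_comp, ha']
    exact congrArg (fun φ => φ p) hc
  let i : E.toOver ≅ A := ⟨a, b, hab, hba⟩
  have : IsIso a.left := inferInstanceAs (IsIso ((Over.forget _).mapIso i).hom)
  refine ⟨IsAffine.of_isIso a.left, ⟨fun p q hpq => ?_, fun f => ?_⟩⟩
  · apply s.injective
    have := congrArg (pull b) hpq
    rw [← RingHom.comp_apply, ← RingHom.comp_apply, hc] at this
    exact this
  · refine ⟨s.symm (pull b f), ?_⟩
    rw [← ha', RingEquiv.apply_symm_apply, ← pull_comp, hab]
    rfl

end Coordinates

/-! ### The basis of additive functions in the presence of coordinates. -/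

section AdditiveFunctions

variable {k L : Type u} [Field k] [Field L] [Algebra k L]
  {E : ModuleScheme k[X] (Spec (CommRingCat.of L))} {d : ℕ} {ξ : Fin d → E.GaHom}

lemma coordinateHom_smul (ξ : Fin d → E.GaHom) (c : L) (p : MvPolynomial (Fin d) L) :
    coordinateHom ξ (c • p) = scalar E.toOver c * coordinateHom ξ p := by
  rw [MvPolynomial.smul_eq_C_mul, map_mul, coordinateHom, MvPolynomial.eval₂Hom_C]

lemma pull_coordinateHom {R : Type u} [CommRing R] [Algebra L R] (x : specOver L R ⟶ E.toOver)
    (u : Fin d → R) (hx : ∀ i, pull x (ξ i).1 = specSections L R (u i))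
    (F : MvPolynomial (Fin d) L) :
    pull x (coordinateHom ξ F) = specSections L R (MvPolynomial.aeval u F) := by
  have : (pull x).comp (coordinateHom ξ) = ((specSections L R : R →+* _).comp
      (MvPolynomial.aeval u : MvPolynomial (Fin d) L →ₐ[L] R).toRingHom :
      MvPolynomial (Fin d) L →+* Γ((specOver L R).left, ⊤)) := by
    apply MvPolynomial.ringHom_ext
    · intro c
      simp [coordinateHom, pull_scalar, specSections_algebraMap]
    · intro i
      simp [coordinateHom, hx]
  exact congrArg (fun φ => φ F) this

variable [Fintype k]

/-- Every tuple in every `L`-algebra `R` is the coordinate tuple of an `R`-point of `E`, so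
additivity on points turns into the polynomial identities required by `mem_span_of_additive`. -/
lemma IsCoordinates.mem_span_of_isGaHom (hξ : IsCoordinates ξ) {F : MvPolynomial (Fin d) L}
    (hF : E.IsGaHom (coordinateHom ξ F)) :
    F ∈ Submodule.span L (Set.range fun x : Fin d × ℕ =>
      (MvPolynomial.X x.1 ^ Fintype.card k ^ x.2 : MvPolynomial (Fin d) L)) := by
  have hp : ∀ (R : Type u) [CommRing R] [Algebra L R] (u : Fin d → R),
      ∃ x : specOver L R ⟶ E.toOver, ∀ i, pull x (ξ i).1 = specSections L R (u i) := by
    intro R _ _ u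
    obtain ⟨x, hx⟩ := (hξ (specOver L R)).2 fun i => specSections L R (u i)
    exact ⟨x, congrFun hx⟩
  refine mem_span_of_additive (k := k) F (fun R _ _ u v => ?_) (fun R _ _ c u => ?_)
  · obtain ⟨x, hx⟩ := hp R u
    obtain ⟨y, hy⟩ := hp R v
    apply (specSections L R).injective
    rw [map_add, ← pull_coordinateHom x u hx, ← pull_coordinateHom y v hy, ← (hF _ x y).1]
    refine (pull_coordinateHom (x + y) (u + v) (fun i => ?_) F).symm
    rw [((ξ i).2 _ x y).1, hx, hy, Pi.add_apply, map_add]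
  · obtain ⟨x, hx⟩ := hp R u
    apply (specSections L R).injective
    rw [map_mul, ← pull_coordinateHom x u hx, specSections_algebraMap, ← (hF _ x x).2]
    refine (pull_coordinateHom _ _ (fun i => ?_) F).symm
    rw [((ξ i).2 _ x x).2, hx, map_mul, specSections_algebraMap]

lemma coe_frob_iterate (n : ℕ) (f : E.GaHom) :
    ((E.frob^[n] f : E.GaHom) : Γ(E.toOver.left, ⊤)) = f.1 ^ Fintype.card k ^ n := by
  induction n with
  | zero => simp
  | succ n ih =>
    rw [Function.iterate_succ_apply', pow_succ, pow_mul, ← ih]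
    rfl

variable (k) in
/-- The additive functions on affine space have the `q`-th power iterates of the coordinates as a
basis. -/
lemma IsCoordinates.exists_basis (hξ : IsCoordinates ξ) :
    ∃ b : Module.Basis (Fin d × ℕ) L E.GaHom, ∀ x, b x = E.frob^[x.2] (ξ x.1) := by
  let : Algebra L Γ(E.toOver.left, ⊤) := (scalar E.toOver).toAlgebra
  let ψ : MvPolynomial (Fin d) L →ₗ[L] Γ(E.toOver.left, ⊤) :=
    { toFun := coordinateHom ξ
      map_add' := map_add (coordinateHom ξ)
      map_smul' := coordinateHom_smul ξ }
  let ι : E.GaHom →ₗ[L] Γ(E.toOver.left, ⊤) :=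
    { E.GaHom.subtype with map_smul' := fun _ _ => rfl }
  have hι : Function.Injective ι := Subtype.val_injective
  have hψ : Function.Bijective ψ := hξ.isAffine_and_bijective.2
  have hv : (ι ∘ fun x : Fin d × ℕ => E.frob^[x.2] (ξ x.1)) =
      ψ ∘ fun x : Fin d × ℕ => (MvPolynomial.X x.1 ^ Fintype.card k ^ x.2) := by
    funext x
    change ((E.frob^[x.2] (ξ x.1) : E.GaHom) : Γ(E.toOver.left, ⊤)) =
      coordinateHom ξ (MvPolynomial.X x.1 ^ Fintype.card k ^ x.2)
    rw [coe_frob_iterate, map_pow, coordinateHom, MvPolynomial.eval₂Hom_X']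
  have hli : LinearIndependent L fun x : Fin d × ℕ => E.frob^[x.2] (ξ x.1) := by
    apply LinearIndependent.of_comp ι
    rw [hv]
    exact (linearIndependent_X_pow d).map' ψ (LinearMap.ker_eq_bot.mpr hψ.1)
  refine ⟨Module.Basis.mk hli fun f _ => ?_, fun x => Module.Basis.mk_apply _ _ _⟩
  obtain ⟨F, hF⟩ := hψ.2 (ι f)
  have hmem := hξ.mem_span_of_isGaHom (F := F) (by
    change E.IsGaHom (ψ F)
    rw [hF]
    exact f.2)
  have h := Submodule.mem_map_of_mem (f := ψ) hmem
  rw [Submodule.map_span, ← Set.range_comp, hF, ← hv, Set.range_comp, ← Submodule.map_span] at h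
  obtain ⟨g, hg, hgf⟩ := h
  rwa [← hι hgf]

end AdditiveFunctions

/-! ### Additive functions and field extension. -/

section Descent

/-- Two functions on a scheme agree if they agree on all affine schemes mapping to it. -/
lemma eq_of_forall_isAffine {K : Type u} [Field K] {T : Over (Spec (CommRingCat.of K))}
    {a b : Γ(T.left, ⊤)}
    (h : ∀ (T' : Over (Spec (CommRingCat.of K))) [IsAffine T'.left] (j : T' ⟶ T),
      pull j a = pull j b) : a = b := by
  refine T.left.affineCover.ext_elem a b fun i => ?_
  let T' : Over (Spec (CommRingCat.of K)) := Over.mk (T.left.affineCover.f i ≫ T.hom)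
  have : IsAffine T'.left := inferInstanceAs (IsAffine (T.left.affineCover.X i))
  exact h T' (Over.homMk (T.left.affineCover.f i) rfl)

variable {k K : Type u} [Field k] [Field K] (E : ModuleScheme k[X] (Spec (CommRingCat.of K)))

/-- An additive function may be tested on affine schemes. -/
lemma isGaHom_of_isAffine [Algebra k K] {f : Γ(E.toOver.left, ⊤)}
    (h : ∀ (T : Over (Spec (CommRingCat.of K))) [IsAffine T.left] (x y : T ⟶ E.toOver),
      pull (x + y) f = pull x f + pull y f ∧
      ∀ c : k, pull ((C c : k[X]) • x) f = scalar T (algebraMap k K c) * pull x f) :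
    E.IsGaHom f := by
  refine fun T x y => ⟨eq_of_forall_isAffine fun T' _ j => ?_, fun c =>
    eq_of_forall_isAffine fun T' _ j => ?_⟩
  · rw [map_add, ← pull_comp, ← pull_comp, ← pull_comp, E.comp_add]
    exact (h T' _ _).1
  · rw [map_mul, ← pull_comp, ← pull_comp, E.comp_smul, pull_scalar]
    exact (h T' _ (j ≫ y)).2 c

variable (L : Type u) [Field L] [Algebra K L]

lemma extendProj_naturality {T X : Over (Spec (CommRingCat.of K))} (x : T ⟶ X) :
    (Over.map (specMap K L)).map ((Over.pullback (specMap K L)).map x) ≫ extendProj L X =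
      extendProj L T ≫ x :=
  (Over.mapPullbackAdj (specMap K L)).counit.naturality x

lemma pointsEquiv_eq {X : Over (Spec (CommRingCat.of K))} {T : Over (Spec (CommRingCat.of L))}
    (x : T ⟶ extend K L X) :
    pointsEquiv (specMap K L) X T x = (Over.map (specMap K L)).map x ≫ extendProj L X :=
  Adjunction.homEquiv_counit (adj := Over.mapPullbackAdj (specMap K L)) _ _ _

/-- The base change of a point of `E`. -/
def extendPoint {T : Over (Spec (CommRingCat.of K))} (x : T ⟶ E.toOver) :
    extend K L T ⟶ (E.baseChange (specMap K L)).toOver :=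
  (Over.pullback (specMap K L)).map x

lemma pointsEquiv_extendPoint {T : Over (Spec (CommRingCat.of K))} (x : T ⟶ E.toOver) :
    pointsEquiv (specMap K L) E.toOver _ (E.extendPoint L x) = extendProj L T ≫ x :=
  (pointsEquiv_eq L _).trans (extendProj_naturality L x)

lemma extendPoint_add {T : Over (Spec (CommRingCat.of K))} (x y : T ⟶ E.toOver) :
    E.extendPoint L (x + y) = E.extendPoint L x + E.extendPoint L y := by
  apply (pointsEquiv (specMap K L) E.toOver _).injective
  rw [pointsEquiv_add, pointsEquiv_extendPoint, pointsEquiv_extendPoint, pointsEquiv_extendPoint,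
    E.comp_add]

lemma extendPoint_smul {T : Over (Spec (CommRingCat.of K))} (a : k[X]) (x : T ⟶ E.toOver) :
    E.extendPoint L (a • x) = a • E.extendPoint L x := by
  apply (pointsEquiv (specMap K L) E.toOver _).injective
  rw [pointsEquiv_smul, pointsEquiv_extendPoint, pointsEquiv_extendPoint, E.comp_smul]

variable (K) in
/-- The pull-back of functions on `X` to `X_L`. -/
def extendFunction (X : Over (Spec (CommRingCat.of K))) :
    Γ(X.left, ⊤) →+* Γ((extend K L X).left, ⊤) :=
  pull (extendProj L X)

lemma extendFunction_scalar (X : Over (Spec (CommRingCat.of K))) (c : K) :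
    extendFunction K L X (scalar X c) = scalar (extend K L X) (algebraMap K L c) :=
  pull_extendProj_scalar L X c

lemma pull_extendPoint {T : Over (Spec (CommRingCat.of K))} (x : T ⟶ E.toOver)
    (a : Γ(E.toOver.left, ⊤)) :
    pull (E.extendPoint L x) (extendFunction K L E.toOver a) =
      extendFunction K L T (pull x a) := by
  have h := congrArg (fun f => pull f a) (extendProj_naturality L x)
  simp only [pull_comp] at h
  exact h

variable {L}

/-- The coordinates of a function on `X_L` for a basis of `L` over `K`. -/
def coordFunction {ι : Type*} (b : Module.Basis ι K L) (X : Over (Spec (CommRingCat.of K)))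
    [IsAffine X.left] (i : ι) : Γ((extend K L X).left, ⊤) →+ Γ(X.left, ⊤) :=
  pushoutCoord (isPushout_scalar L X) b i

lemma coordFunction_mul {ι : Type*} (b : Module.Basis ι K L) (X : Over (Spec (CommRingCat.of K)))
    [IsAffine X.left] (i : ι) (a : Γ(X.left, ⊤)) (f : Γ((extend K L X).left, ⊤)) :
    coordFunction b X i (extendFunction K L X a * f) = a * coordFunction b X i f :=
  pushoutCoord_mul (isPushout_scalar L X) b i a f

/-- The coordinates of a function on `E_L` for a basis of `L` over `K`. -/
def baseChangeCoord {ι : Type*} (b : Module.Basis ι K L) [IsAffine E.toOver.left] (i : ι) :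
    Γ((E.baseChange (specMap K L)).toOver.left, ⊤) →+ Γ(E.toOver.left, ⊤) :=
  coordFunction b E.toOver i

lemma coordFunction_pull {ι : Type*} (b : Module.Basis ι K L)
    {T : Over (Spec (CommRingCat.of K))} [IsAffine T.left] [IsAffine E.toOver.left]
    (x : T ⟶ E.toOver) (i : ι) (f : Γ((E.baseChange (specMap K L)).toOver.left, ⊤)) :
    coordFunction b T i (pull (E.extendPoint L x) f) = pull x (E.baseChangeCoord b i f) :=
  pushoutCoord_naturality (isPushout_scalar L E.toOver) (isPushout_scalar L T) b (pull x)
    (pull (E.extendPoint L x)) (E.pull_extendPoint L x) (pull_scalar _) i f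

variable [Algebra k K] [Algebra k L] [IsScalarTower k K L]

/-- Taking coordinates commutes with pull-back along base-changed points, so additivity and
`k`-linearity pass to each coordinate; they need only be tested on affine `T`. -/
lemma isGaHom_baseChangeCoord {ι : Type*} (b : Module.Basis ι K L) [IsAffine E.toOver.left] (i : ι)
    (f : (E.baseChange (specMap K L)).GaHom) : E.IsGaHom (E.baseChangeCoord b i f.1) := by
  refine E.isGaHom_of_isAffine fun T _ x y => ⟨?_, fun c => ?_⟩
  · rw [← coordFunction_pull, ← coordFunction_pull, ← coordFunction_pull, extendPoint_add,
      (f.2 _ _ _).1, map_add]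
  · rw [← coordFunction_pull, ← coordFunction_pull, extendPoint_smul,
      (f.2 _ _ (E.extendPoint L x)).2, IsScalarTower.algebraMap_apply k K L,
      ← extendFunction_scalar, coordFunction_mul]

/-- Expanding an additive function in a `K`-basis of `L` writes it as an `L`-combination of its
coordinates, which are additive functions on `E`. -/
lemma mem_span_gaHomBaseChange [IsAffine E.toOver.left]
    (f : (E.baseChange (specMap K L)).GaHom) :
    f ∈ Submodule.span L (Set.range (E.gaHomBaseChange L)) := by
  let b := Module.Basis.ofVectorSpace K L
  obtain ⟨t, ht⟩ := pushout_eq_sum (isPushout_scalar L E.toOver) b f.1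
  have hf : f = ∑ i ∈ t, b i • E.gaHomBaseChange L ⟨_, E.isGaHom_baseChangeCoord b i f⟩ := by
    apply Subtype.ext
    rw [AddSubgroup.val_finsetSum]
    refine ht.trans (Finset.sum_congr rfl fun i _ => ?_)
    exact mul_comm _ _
  rw [hf]
  exact Submodule.sum_mem _ fun i _ => Submodule.smul_mem _ _ (Submodule.subset_span ⟨_, rfl⟩)

end Descent

/-! ### `M_E` is geometrically free over `K[σ]` and generates the functions on `E`. -/

section Geometric

variable {k K : Type u} [Field k] [Field K] [Algebra k K]
  (E : ModuleScheme k[X] (Spec (CommRingCat.of K)))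
  {L : Type u} [Field L] [Algebra k L] [Algebra K L] [IsScalarTower k K L]
  {d : ℕ} {ξ : Fin d → (E.baseChange (specMap K L)).GaHom}

lemma GaHom.C_smul (c : K) (m : E.GaHom) : (C c : K[X]) • m = c • m := by
  rw [GaHom.poly_smul, aeval_C, Module.algebraMap_end_apply]

lemma GaHom.X_smul (m : E.GaHom) : (X : K[X]) • m = E.tEnd m := by
  rw [GaHom.poly_smul, aeval_X]

omit [Algebra k K] [IsScalarTower k K L] in
lemma isAffine_of_isCoordinates (hξ : IsCoordinates ξ) : IsAffine E.toOver.left := by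
  have : IsAffine (extend K L E.toOver).left := hξ.isAffine_and_bijective.1
  exact isAffine_of_isPullback (Y := (extend K L E.toOver).left) (isPullback_extendProj L E.toOver)

variable (L) in
/-- A semilinear map on the additive functions on `E` extends to the additive functions on `E_L`. -/
lemma exists_lift_gaHom [IsAffine E.toOver.left] (W : Type u) [AddCommGroup W] [Module L W]
    (f : E.GaHom →+ W) (hf : ∀ (c : K) m, f (c • m) = algebraMap K L c • f m) :
    ∃ g : (E.baseChange (specMap K L)).GaHom →ₗ[L] W,
      ∀ m, g (E.gaHomBaseChange L m) = f m := by
  let : Module K Γ(E.toOver.left, ⊤) := Module.compHom _ (scalar E.toOver)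
  let ι : E.GaHom →ₗ[K] Γ(E.toOver.left, ⊤) :=
    { E.GaHom.subtype with map_smul' := fun _ _ => rfl }
  -- A linear retraction of the functions on `E` onto `M_E` lets `f` be extended to all functions,
  -- then to `L ⊗ Γ(E)`, and finally restricted to the additive functions on `E_L`.
  obtain ⟨r, hr⟩ := ι.exists_leftInverse_of_injective
    (LinearMap.ker_eq_bot.mpr Subtype.val_injective)
  have hr' : ∀ m : E.GaHom, r m.1 = m := fun m => congrArg (fun f => f m) hr
  obtain ⟨g, hg, hgf⟩ := exists_lift_of_isPushout (isPushout_scalar L E.toOver) W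
    (f.comp r.toAddMonoidHom) (fun c a => (congrArg f (r.map_smul c a)).trans (hf c (r a)))
  let g' : Γ((E.baseChange (specMap K L)).toOver.left, ⊤) →+ W := g
  refine ⟨{ g'.comp (E.baseChange (specMap K L)).GaHom.subtype with
    map_smul' := fun c m => hg c m.1 }, fun m => ?_⟩
  exact (hgf m.1).trans (congrArg f (hr' m))

variable {E}

/-- The additive functions on `E_L`, where `L` is a field over which `E` becomes isomorphic to
affine space. -/
def IsCoordinates.freeBaseChange [Fintype k] (hξ : IsCoordinates ξ) :
    E.sigmaModule.FreeBaseChange L d where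
  V := (E.baseChange (specMap K L)).GaHom
  σ := (E.baseChange (specMap K L)).frob
  σ_smul := (E.baseChange (specMap K L)).frob_smul
  j :=
    { toFun := E.gaHomBaseChange L
      map_zero' := Subtype.ext (map_zero (pull (E.proj L)))
      map_add' := fun f g => Subtype.ext (map_add (pull (E.proj L)) f.1 g.1) }
  j_smul c m := by
    apply Subtype.ext
    change pull (E.proj L) ((C c : K[X]) • m : E.GaHom).1 = _
    rw [GaHom.C_smul, GaHom.coe_smul, map_mul, pull_scalar, scalar_map]
    rfl
  j_sigma m := Subtype.ext (map_pow (pull (E.proj L)) m.1 _)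
  basis := (hξ.exists_basis k).choose
  basis_succ i n := by
    rw [(hξ.exists_basis k).choose_spec, (hξ.exists_basis k).choose_spec,
      Function.iterate_succ_apply']
  exists_lift W _ _ f hf := by
    have := E.isAffine_of_isCoordinates hξ
    exact E.exists_lift_gaHom L W f fun c m => by rw [← hf, GaHom.C_smul]
  mem_span v := by
    have := E.isAffine_of_isCoordinates hξ
    exact E.mem_span_gaHomBaseChange v

/-- The functions on `E` are generated by the additive functions. -/
lemma IsCoordinates.function_induction (hξ : IsCoordinates ξ) {P : Γ(E.toOver.left, ⊤) → Prop}
    (hs : ∀ c, P (scalar E.toOver c)) (hm : ∀ m : E.GaHom, P m.1)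
    (hadd : ∀ a b, P a → P b → P (a + b)) (hmul : ∀ a b, P a → P b → P (a * b))
    (f : Γ(E.toOver.left, ⊤)) : P f := by
  have := E.isAffine_of_isCoordinates hξ
  let : Algebra K Γ(E.toOver.left, ⊤) := (scalar E.toOver).toAlgebra
  let S := Algebra.adjoin K (E.GaHom : Set Γ(E.toOver.left, ⊤))
  suffices hS : f ∈ S by
    induction hS using Algebra.adjoin_induction with
    | mem x hx => exact hm ⟨x, hx⟩
    | algebraMap c => exact hs c
    | add x y _ _ hx hy => exact hadd x y hx hy
    | mul x y _ _ hx hy => exact hmul x y hx hy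
  by_contra hf
  -- A linear form that vanishes on `S` but not at `f` is extended to an `L`-linear form `g` on the
  -- functions of `E_L`. It will turn out to be zero, a contradiction.
  obtain ⟨φ, hφf, hφ⟩ := Submodule.exists_le_ker_of_notMem (p := Subalgebra.toSubmodule S) hf
  obtain ⟨g', hg', hgφ⟩ := exists_lift_of_isPushout (isPushout_scalar L E.toOver) L
    ((algebraMap K L).toAddMonoidHom.comp φ.toAddMonoidHom) (fun c a => by
      change algebraMap K L (φ (c • a)) = algebraMap K L c * algebraMap K L (φ a)
      rw [map_smul, smul_eq_mul, map_mul])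
  let B := Γ((E.baseChange (specMap K L)).toOver.left, ⊤)
  let p : Γ(E.toOver.left, ⊤) →+* B := pull (E.proj L)
  let g : B →+ L := g'
  have hg : ∀ (c : L) (b : B), g (scalar (E.baseChange (specMap K L)).toOver c * b) = c * g b := hg'
  have hgp : ∀ a, g (p a) = algebraMap K L (φ a) := hgφ
  -- The factor `s` must vary in the induction: each coordinate is an `L`-combination of additive
  -- functions on `E`, and these are absorbed into `s`.
  have key : ∀ F : MvPolynomial (Fin d) L, ∀ s ∈ S, g (coordinateHom ξ F * p s) = 0 := by
    intro F
    induction F using MvPolynomial.induction_on with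
    | C c =>
      intro s hs
      rw [coordinateHom, MvPolynomial.eval₂Hom_C, hg, hgp, hφ hs, map_zero, mul_zero]
    | add F G hF hG =>
      intro s hs
      rw [map_add, add_mul, map_add, hF s hs, hG s hs, add_zero]
    | mul_X F i hF =>
      have hi : ∀ v ∈ Submodule.span L (Set.range (E.gaHomBaseChange L)), ∀ s ∈ S,
          g (coordinateHom ξ F * v.1 * p s) = 0 := by
        intro v hv
        induction hv using Submodule.span_induction with
        | mem v hv =>
          obtain ⟨m, rfl⟩ := hv
          intro s hs
          have := hF _ (S.mul_mem (Algebra.subset_adjoin m.2) hs)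
          rw [map_mul p, ← mul_assoc] at this
          exact this
        | zero => intro s hs; simp
        | add v w _ _ hv hw =>
          intro s hs
          rw [AddSubgroup.coe_add, mul_add, add_mul, map_add, hv s hs, hw s hs, add_zero]
        | smul c v _ hv =>
          intro s hs
          rw [GaHom.coe_smul, mul_left_comm, mul_assoc, hg, hv s hs, mul_zero]
      intro s hs
      rw [map_mul (coordinateHom ξ)]
      nth_rw 2 [coordinateHom]
      rw [MvPolynomial.eval₂Hom_X']
      exact hi _ (E.mem_span_gaHomBaseChange (ξ i)) s hs
  obtain ⟨F, hF⟩ := hξ.isAffine_and_bijective.2.2 (p f)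
  have h := key F 1 S.one_mem
  rw [map_one, mul_one, hF, hgp] at h
  exact hφf ((map_eq_zero _).mp h)

end Geometric

/-! ### Rational points as functionals on `M_E`. -/

section Points

variable {k K : Type u} [Field k] [Field K] [Algebra k K]
  (E : ModuleScheme k[X] (Spec (CommRingCat.of K)))

/-- The value of an additive function at a rational point. -/
def evalPoint : E.points K →+ (E.GaHom →+ K) :=
  AddMonoidHom.mk' (fun x =>
    { toFun := fun m => (specSections K K).symm (pull x m.1)
      map_zero' := by simp
      map_add' := by simp }) (fun x y => AddMonoidHom.ext fun m => by
    change (specSections K K).symm (pull (x + y) m.1) =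
      (specSections K K).symm (pull x m.1) + (specSections K K).symm (pull y m.1)
    rw [(m.2 _ x y).1, map_add])

variable {E}

lemma specSections_evalPoint (x : E.points K) (m : E.GaHom) :
    specSections K K (E.evalPoint x m) = pull x m.1 :=
  (specSections K K).apply_symm_apply _

lemma evalPoint_eq_iff (x : E.points K) (m : E.GaHom) (c : K) :
    E.evalPoint x m = c ↔ pull x m.1 = specSections K K c := by
  rw [← specSections_evalPoint]
  exact (specSections K K).injective.eq_iff.symm

lemma specSections_self (c : K) : specSections K K c = scalar (specOver K K) c :=
  specSections_algebraMap c

lemma isPairing_evalPoint [Fintype k] :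
    SigmaModule.IsPairing (M := E.sigmaModule) E.evalPoint where
  functional x :=
    { smul := fun c m => by
        rw [evalPoint_eq_iff, GaHom.C_smul, GaHom.coe_smul, map_mul, pull_scalar, map_mul,
          specSections_evalPoint, Algebra.algebraMap_self_apply, specSections_self]
      sigma := fun m => by
        rw [evalPoint_eq_iff, map_pow, specSections_evalPoint]
        exact map_pow (pull x) m.1 _ }
  X_smul x m := by
    rw [evalPoint_eq_iff, specSections_evalPoint, GaHom.X_smul, ← comp_smul_id, pull_comp]
    rfl
  C_smul c x m := by
    rw [evalPoint_eq_iff, map_mul, specSections_evalPoint, (m.2 _ x x).2, specSections_self]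

lemma evalPoint_comp {F : ModuleScheme k[X] (Spec (CommRingCat.of K))} [Fintype k] (φ : E.Hom F)
    (x : E.points K) (m : F.GaHom) :
    F.evalPoint (x ≫ φ.hom) m = E.evalPoint x (gaHomMap φ m) := by
  rw [evalPoint_eq_iff, specSections_evalPoint, pull_comp]
  rfl

section BaseChange

variable {L : Type u} [Field L] [Algebra k L] [Algebra K L] [IsScalarTower k K L]
  {d : ℕ} {ξ : Fin d → (E.baseChange (specMap K L)).GaHom}

omit [Algebra k K] [Algebra k L] [IsScalarTower k K L] in
lemma pull_pull_proj {T : Over (Spec (CommRingCat.of L))}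
    (x : T ⟶ (E.baseChange (specMap K L)).toOver) (f : Γ(E.toOver.left, ⊤)) :
    pull x (pull (E.proj L) f) = pull (pointsEquiv (specMap K L) E.toOver T x) f := by
  exact (pull_comp ((Over.map (specMap K L)).map x) (E.proj L) f).symm.trans
    (congrArg (fun y => pull y f) (pointsEquiv_eq L x).symm)

lemma gaHomBaseChange_tEnd (m : E.GaHom) :
    E.gaHomBaseChange L (E.tEnd m) = (E.baseChange (specMap K L)).tEnd (E.gaHomBaseChange L m) := by
  apply Subtype.ext
  change pull (E.proj L) (pull ((X : k[X]) • 𝟙 E.toOver) m.1) =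
    pull ((X : k[X]) • 𝟙 (E.baseChange (specMap K L)).toOver) (pull (E.proj L) m.1)
  rw [pull_pull_proj, ← pull_comp, comp_smul_id, pointsEquiv_smul]
  have : pointsEquiv (specMap K L) E.toOver _ (𝟙 (E.baseChange (specMap K L)).toOver) =
      E.proj L := by
    refine (pointsEquiv_eq L _).trans ?_
    refine (congrArg (· ≫ _) ((Over.map (specMap K L)).map_id _)).trans (Category.id_comp _)
  rw [this]

lemma specSections_naturality (c : K) :
    pull (Over.homMk (U := (Over.map (specMap K L)).obj (specOver L L)) (V := specOver K K)
      (specMap K L) (by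
        change Spec.map _ ≫ Spec.map _ = Spec.map _ ≫ Spec.map _
        rw [← Spec.map_comp, ← Spec.map_comp]
        rfl)) (specSections K K c) = specSections L L (algebraMap K L c) := by
  have := Scheme.ΓSpecIso_inv_naturality (CommRingCat.ofHom (algebraMap K L))
  exact (congrArg (fun f => f.hom c) this).symm

lemma evalPoint_pointsBaseChange (x : E.points K) (m : E.GaHom) :
    (E.baseChange (specMap K L)).evalPoint (E.pointsBaseChange L x) (E.gaHomBaseChange L m) =
      algebraMap K L (E.evalPoint x m) := by
  rw [evalPoint_eq_iff]
  change pull (E.pointsBaseChange L x) (pull (E.proj L) m.1) = _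
  rw [pull_pull_proj, pointsBaseChange, Equiv.apply_symm_apply, pull_comp,
    ← specSections_evalPoint]
  exact specSections_naturality _

/-- Points of `E` are determined by the values of the additive functions. -/
lemma IsCoordinates.hom_ext (hξ : IsCoordinates ξ) {T : Over (Spec (CommRingCat.of K))} {x y : T ⟶ E.toOver}
    (h : ∀ m : E.GaHom, pull x m.1 = pull y m.1) :
    x = y := by
  have := E.isAffine_of_isCoordinates hξ
  refine hom_ext_of_isAffine fun f => ?_
  refine hξ.function_induction (P := fun f => pull x f = pull y f) ?_ h ?_ ?_ f
  · intro c
    rw [pull_scalar, pull_scalar]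
  · intro a b ha hb
    rw [map_add, map_add, ha, hb]
  · intro a b ha hb
    rw [map_mul, map_mul, ha, hb]

lemma IsCoordinates.evalPoint_injective (hξ : IsCoordinates ξ) :
    Function.Injective E.evalPoint := by
  intro x y h
  refine hξ.hom_ext fun m => ?_
  rw [← specSections_evalPoint, h, specSections_evalPoint]

/-- Every functional on `M_E` is given by a rational point. -/
lemma IsCoordinates.evalPoint_surjective [Fintype k] (hξ : IsCoordinates ξ) (x : E.GaHom →+ K)
    (hx : SigmaModule.IsFunctional (M := E.sigmaModule) x) : ∃ y, E.evalPoint y = x := by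
  have := E.isAffine_of_isCoordinates hξ
  obtain ⟨g, hg, hgσ⟩ : ∃ g : (E.baseChange (specMap K L)).GaHom →ₗ[L] L,
      (∀ m, g (E.gaHomBaseChange L m) = algebraMap K L (x m)) ∧
      ∀ v, g ((E.baseChange (specMap K L)).frob v) = g v ^ Fintype.card k :=
    hξ.freeBaseChange.exists_functional_lift x hx
  -- The `L`-point with coordinates `g (ξ i)`. As `g` and evaluation at `p` both turn `frob` into
  -- the `q`-th power, they agree on the whole basis, so on all additive functions.
  obtain ⟨p, hp⟩ := (hξ (specOver L L)).2 fun i => specSections L L (g (ξ i))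
  have hp' : ∀ v : (E.baseChange (specMap K L)).GaHom, (E.baseChange (specMap K L)).evalPoint p v = g v := by
    obtain ⟨b, hb⟩ := hξ.exists_basis k
    let g' : (E.baseChange (specMap K L)).GaHom →ₗ[L] L := { (E.baseChange (specMap K L)).evalPoint p with
      map_smul' := fun c m => by
        have := (isPairing_evalPoint (E := E.baseChange (specMap K L))).functional p |>.smul c m
        rw [GaHom.C_smul] at this
        exact this }
    have : g' = g := by
      refine b.ext fun ⟨i, n⟩ => ?_
      rw [hb]
      induction n with
      | zero => exact (evalPoint_eq_iff _ _ _).mpr (congrFun hp i)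
      | succ n ih =>
        rw [Function.iterate_succ_apply', hgσ, ← ih]
        exact (isPairing_evalPoint (E := E.baseChange (specMap K L))).functional p |>.sigma _
    exact fun v => congrArg (fun g => g v) this
  let ρ : Γ(E.toOver.left, ⊤) →+* L :=
    ((specSections L L).symm : _ →+* L).comp ((pull p).comp (pull (E.proj L)))
  have hρm : ∀ m : E.GaHom, ρ m.1 = algebraMap K L (x m) := fun m =>
    (hp' (E.gaHomBaseChange L m)).trans (hg m)
  have hρs : ∀ c, ρ (scalar E.toOver c) = algebraMap K L c := by
    intro c
    change (specSections L L).symm (pull p (pull (E.proj L) (scalar E.toOver c))) = _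
    rw [pull_scalar, scalar_map, pull_scalar, ← specSections_self, RingEquiv.symm_apply_apply]
  -- On `M_E` the values are those of `x`, which lie in `K`. Since `M_E` generates the functions on
  -- `E`, the `L`-point is defined over `K`.
  have hρ : ∀ f, ∃ c, algebraMap K L c = ρ f := by
    intro f
    refine hξ.function_induction (P := fun f => ∃ c, algebraMap K L c = ρ f) ?_ ?_ ?_ ?_ f
    · exact fun c => ⟨c, (hρs c).symm⟩
    · exact fun m => ⟨x m, (hρm m).symm⟩
    · rintro a b ⟨c, hc⟩ ⟨c', hc'⟩
      exact ⟨c + c', by rw [map_add, map_add, hc, hc']⟩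
    · rintro a b ⟨c, hc⟩ ⟨c', hc'⟩
      exact ⟨c * c', by rw [map_mul, map_mul, hc, hc']⟩
  choose φ hφ using hρ
  have hinj := (algebraMap K L).injective
  obtain ⟨y, hy⟩ := exists_hom_specOver (K := K) (R := K) (X := E.toOver)
    { toFun := φ
      map_one' := hinj (by rw [hφ, map_one, map_one])
      map_mul' := fun a b => hinj (by rw [hφ, map_mul, map_mul, hφ, hφ])
      map_zero' := hinj (by rw [hφ, map_zero, map_zero])
      map_add' := fun a b => hinj (by rw [hφ, map_add, map_add, hφ, hφ]) }
    (fun c => hinj ((hφ _).trans (hρs c)))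
  refine ⟨y, AddMonoidHom.ext fun m => (evalPoint_eq_iff _ _ _).mpr ((hy _).trans ?_)⟩
  exact congrArg _ (hinj ((hφ _).trans (hρm m)))

end BaseChange

end Points

end ModuleScheme

/-! ### Functionals of sections under base change of extensions. -/

section

variable {k K K' : Type u} [Field k] [Fintype k] [Field K] [Algebra k K] [Field K'] [Algebra k K']
  [Algebra K K']

/-- The functionals of sections of two extensions agree if one extension is the base change of the
other. -/
lemma SigmaModule.functional_baseChange {M : SigmaModule k K} {M' : SigmaModule k K'}
    (hM : M.SigmaFinite) (bc : M.carrier →+ M'.carrier)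
    (bcC : ∀ (c : K) m, bc ((C c : K[X]) • m) = (C (algebraMap K K' c) : K'[X]) • bc m)
    (bcσ : ∀ m, bc (M.sigma m) = M'.sigma (bc m))
    (bcX : ∀ m, bc ((X : K[X]) • m) = (X : K'[X]) • bc m)
    {N : ModuleCat.{u} (SkewRing k K)} (i : (unit k K).toModuleCat ⟶ N) (π : N ⟶ M.toModuleCat)
    {N' : ModuleCat.{u} (SkewRing k K')} (i' : (unit k K').toModuleCat ⟶ N')
    (π' : N' ⟶ M'.toModuleCat) (w' : i' ≫ π' = 0) (hS' : (ShortComplex.mk i' π' w').ShortExact)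
    (g : N →+ N')
    (hgp : ∀ (p : K[X]) n, g (SkewRing.ofPoly k K p • n) =
      SkewRing.ofPoly k K' (p.map (algebraMap K K')) • g n)
    (hgσ : ∀ n, g (SkewRing.sigma k K • n) = SkewRing.sigma k K' • g n)
    (hgi : ∀ p : K[X], g (i.hom p) = i'.hom (p.map (algebraMap K K')))
    (hgπ : ∀ n, π'.hom (g n) = bc (π.hom n))
    {y : M.carrier →+ K} (s : M.carrier →+ N) (hs : IsScalarEquivariant s)
    (hπ : ∀ m, π.hom (s m) = m)
    (hX : ∀ m, SkewRing.ofPoly k K X • s m - s ((X : K[X]) • m) = i.hom (C (y m) : K[X]))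
    {y' : M'.carrier →+ K'} (s' : M'.carrier →+ N') (hs' : IsScalarEquivariant s')
    (hπ' : ∀ m, π'.hom (s' m) = m)
    (hX' : ∀ m, SkewRing.ofPoly k K' X • s' m - s' ((X : K'[X]) • m) =
      i'.hom (C (y' m) : K'[X])) (m : M.carrier) :
    y' (bc m) = algebraMap K K' (y m) := by
  have hinj : Function.Injective i'.hom := (ModuleCat.mono_iff_injective i').mp hS'.mono_f
  let iAdd : K'[X] →+ N' := i'.hom.toAddMonoidHom
  have iC : ∀ p r : K'[X], iAdd (p * r) = SkewRing.ofPoly k K' p • iAdd r := unit_ofPoly_smul i'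
  have iσ : ∀ r : K'[X], iAdd (tau k K' r) = SkewRing.sigma k K' • iAdd r := unit_sigma_smul i'
  replace hgi : ∀ p : K[X], g (i.hom p) = iAdd (p.map (algebraMap K K')) := hgi
  replace hX' : ∀ m, SkewRing.ofPoly k K' X • s' m - s' ((X : K'[X]) • m) = iAdd (C (y' m)) := hX'
  replace hinj : Function.Injective iAdd := hinj
  -- The two ways from `M` to `N'` differ by a map `h` to `K'[t]`, which is `σ`-equivariant with
  -- constant `t`-defect `y - y' ∘ bc`. Hence `h = 0`, and so is this defect.
  obtain ⟨h, hh⟩ := exists_addMonoidHom_lift iAdd hinj (g.comp s - s'.comp bc) (fun m =>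
    (ShortComplex.moduleCat_exact_iff _).mp hS'.exact _ (by
      change π'.hom (g (s m) - s' (bc m)) = 0
      rw [map_sub, hgπ, hπ, hπ', sub_self]))
  replace hh : ∀ m, iAdd (h m) = g (s m) - s' (bc m) := hh
  clear_value iAdd
  have hC : ∀ (c : K) m, h ((C c : K[X]) • m) = C (algebraMap K K' c) * h m := by
    intro c m
    apply hinj
    rw [iC, hh, hh, bcC, hs'.smul, hs.smul, hgp, smul_sub, map_C]
  have hσ : ∀ m, tau k K' (h m) = h (M.sigma m) := by
    intro m
    apply hinj
    rw [iσ, hh, hh, bcσ, hs'.sigma, hs.sigma, hgσ, smul_sub]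
  have hXm : ∀ m, X * h m - h ((X : K[X]) • m) = C (algebraMap K K' (y m) - y' (bc m)) := by
    intro m
    apply hinj
    have h1 := hX' (bc m)
    have h2 := congrArg g (hX m)
    rw [map_sub, hgp, Polynomial.map_X, hgi, Polynomial.map_C] at h2
    rw [map_sub, iC, hh, hh, smul_sub, bcX, sub_sub_sub_comm, h2, h1, C_sub, map_sub]
  have h0 := eq_zero_of_equivariant hM h hC hσ fun m => ⟨_, hXm m⟩
  have := hXm m
  rw [h0, h0, mul_zero, sub_zero, eq_comm, C_eq_zero] at this
  exact (sub_eq_zero.mp this).symm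

end

namespace ModuleScheme

/-! ### The isomorphism, its functoriality and base change. -/

section Main

variable {k K : Type u} [Field k] [Fintype k] [Field K] [Algebra k K]
  {E : ModuleScheme k[X] (Spec (CommRingCat.of K))}

omit [Fintype k] in
lemma IsAbelian.exists_isCoordinates {θ : K} (h : E.IsAbelian θ) :
    ∃ (d : ℕ) (ξ : Fin d → (E.baseChange (specMap K (AlgebraicClosure K))).GaHom),
      IsCoordinates ξ := by
  obtain ⟨d, hd⟩ := h.iso_gaPow
  exact ⟨d, hd.exists_isCoordinates⟩

lemma IsAbelian.sigmaFinite {θ : K} (h : E.IsAbelian θ) : E.sigmaModule.SigmaFinite := by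
  obtain ⟨d, ξ, hξ⟩ := h.exists_isCoordinates
  exact hξ.freeBaseChange.sigmaFinite

lemma IsAbelian.coboundarySurjective {θ : K} (h : E.IsAbelian θ) :
    E.sigmaModule.CoboundarySurjective (AlgebraicClosure K) := by
  obtain ⟨d, ξ, hξ⟩ := h.exists_isCoordinates
  exact hξ.freeBaseChange.coboundarySurjective

omit [Fintype k] in
lemma IsAbelian.evalPoint_injective {θ : K} (h : E.IsAbelian θ) :
    Function.Injective E.evalPoint := by
  obtain ⟨d, ξ, hξ⟩ := h.exists_isCoordinates
  exact hξ.evalPoint_injective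

lemma IsAbelian.evalPoint_surjective {θ : K} (h : E.IsAbelian θ) (x : E.GaHom →+ K)
    (hx : SigmaModule.IsFunctional (M := E.sigmaModule) x) : ∃ y, E.evalPoint y = x := by
  obtain ⟨d, ξ, hξ⟩ := h.exists_isCoordinates
  exact hξ.evalPoint_surjective x hx

variable (E) in
/-- The `k[t]`-linear map from the rational points of `E` to the extensions of `M_E` by `K[t]`. -/
def pointExt : E.points K →ₗ[k[X]] E.Ext1 :=
  SigmaModule.pairingExt (M := E.sigmaModule) E.evalPoint isPairing_evalPoint

lemma IsAbelian.pointExt_bijective {θ : K} (h : E.IsAbelian θ) :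
    Function.Bijective E.pointExt := by
  refine ⟨(injective_iff_map_eq_zero E.pointExt).mpr fun x hx => ?_, fun e => ?_⟩
  · apply h.evalPoint_injective
    rw [map_zero]
    exact SigmaModule.functionalExt_eq_zero h.sigmaFinite _ _ hx
  · obtain ⟨x, hx, rfl⟩ :=
      SigmaModule.functionalExt_surjective h.sigmaFinite h.coboundarySurjective e
    obtain ⟨y, rfl⟩ := h.evalPoint_surjective x hx
    exact ⟨y, rfl⟩

lemma pointExt_comp {F : ModuleScheme k[X] (Spec (CommRingCat.of K))} (φ : E.Hom F)
    (x : E.points K) : F.pointExt (x ≫ φ.hom) = ext1Map φ (E.pointExt x) :=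
  SigmaModule.functionalExt_comp (M := F.sigmaModule) (M' := E.sigmaModule) (gaHomMap φ) _
    (E.evalPoint x) (isPairing_evalPoint.functional x) (F.evalPoint (x ≫ φ.hom))
    (isPairing_evalPoint.functional _) (evalPoint_comp φ x)

/-- The extension class of `S` determines the functional of a section of `S`. -/
lemma IsAbelian.exists_section {θ : K} (h : E.IsAbelian θ) (S : Extension E) :
    ∃ (x : E.points K) (s : E.GaHom →+ S.M),
      E.pointExt x = S.extClass ∧
      SigmaModule.IsScalarEquivariant (M := E.sigmaModule) s ∧ (∀ m, S.π.hom (s m) = m) ∧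
      ∀ m, SkewRing.ofPoly k K X • s m - s ((X : K[X]) • m) = S.i.hom (C (E.evalPoint x m) : K[X]) := by
  obtain ⟨y, s, hy, hs, hπ, hX⟩ := SigmaModule.exists_section h.sigmaFinite h.coboundarySurjective
    S.i S.π S.zero S.exact
  obtain ⟨x, rfl⟩ := h.evalPoint_surjective y hy
  refine ⟨x, s, SigmaModule.functionalExt_eq_extClass S.i S.π S.zero S.exact _ _ s hs hπ hX, hs, hπ, hX⟩

omit [Fintype k] in
lemma gaHomBaseChange_C_smul {K' : Type u} [Field K'] [Algebra k K'] [Algebra K K']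
    [IsScalarTower k K K'] (c : K) (m : E.GaHom) :
    E.gaHomBaseChange K' ((C c : K[X]) • m) =
      (C (algebraMap K K' c) : K'[X]) • E.gaHomBaseChange K' m := by
  rw [GaHom.C_smul, GaHom.C_smul]
  apply Subtype.ext
  change pull (E.proj K') (c • m : E.GaHom).1 = _
  rw [GaHom.coe_smul, map_mul, pull_scalar, scalar_map]
  rfl

omit [Fintype k] in
lemma gaHomBaseChange_X_smul {K' : Type u} [Field K'] [Algebra k K'] [Algebra K K']
    [IsScalarTower k K K'] (m : E.GaHom) :
    E.gaHomBaseChange K' ((X : K[X]) • m) = (X : K'[X]) • E.gaHomBaseChange K' m := by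
  rw [GaHom.X_smul, GaHom.X_smul, gaHomBaseChange_tEnd]

/-- No comparison of `Ext` groups over the two fields is needed: both extensions have sections with
constant `t`-defect, these defects are evaluations at points, and `functional_baseChange` matches
the two evaluations on `M_E`. -/
theorem pointExt_baseChange {K' : Type u} [Field K'] [Algebra k K'] [Algebra K K']
    [IsScalarTower k K K'] {θ : K} {θ' : K'} (hE : E.IsAbelian θ)
    (hE' : (E.baseChange (specMap K K')).IsAbelian θ') (S : Extension E)
    (S' : Extension (E.baseChange (specMap K K'))) (hS : S.IsBaseChange S') (x : E.points K)
    (hx : E.pointExt x = S.extClass) :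
    (E.baseChange (specMap K K')).pointExt (E.pointsBaseChange K' x) = S'.extClass := by
  obtain ⟨x₀, s, hx₀, hs, hπ, hX⟩ := hE.exists_section S
  obtain ⟨x', s', hx', hs', hπ', hX'⟩ := hE'.exists_section S'
  obtain rfl : x = x₀ := hE.pointExt_bijective.1 (hx.trans hx₀.symm)
  obtain ⟨g, hgp, hgσ, hgi, hgπ⟩ := hS
  have hval := SigmaModule.functional_baseChange (M := E.sigmaModule)
    (M' := (E.baseChange (specMap K K')).sigmaModule) hE.sigmaFinite
    { toFun := E.gaHomBaseChange K'
      map_zero' := Subtype.ext (map_zero (pull (E.proj K')))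
      map_add' := fun f g => Subtype.ext (map_add (pull (E.proj K')) f.1 g.1) }
    gaHomBaseChange_C_smul
    (fun m => Subtype.ext (map_pow (pull (E.proj K')) m.1 _))
    gaHomBaseChange_X_smul S.i S.π S'.i S'.π S'.zero S'.exact g hgp hgσ hgi hgπ
    s hs hπ hX s' hs' hπ' hX'
  -- Both are `K'`-points of `E`, so it suffices to compare their values on additive functions
  -- defined over `K`.
  have hxx : E.pointsBaseChange K' x = x' := by
    apply (pointsEquiv (specMap K K') E.toOver _).injective
    obtain ⟨d, ξ, hξ⟩ := hE.exists_isCoordinates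
    refine hξ.hom_ext fun m => ?_
    rw [← pull_pull_proj, ← pull_pull_proj]
    have := (evalPoint_pointsBaseChange x m).trans (hval m).symm
    exact (specSections K' K').symm.injective this
  rw [hxx, hx']

end Main

end ModuleScheme

end

end TMotif

theorem mainTheorem4 (k : Type u) [Field k] [Fintype k] :
    ∃ Φ : ∀ (K : Type u) [Field K] [Algebra k K] (θ : K)
        (E : TMotif.ModuleScheme k[X] (Spec (CommRingCat.of K))), E.IsAbelian θ →
        (E.points K ≃ₗ[k[X]] E.Ext1),
      (∀ (K : Type u) [Field K] [Algebra k K] (θ : K)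
        (E F : TMotif.ModuleScheme k[X] (Spec (CommRingCat.of K)))
        (hE : E.IsAbelian θ) (hF : F.IsAbelian θ) (φ : E.Hom F) (x : E.points K),
        Φ K θ F hF (x ≫ φ.hom) = TMotif.ModuleScheme.ext1Map φ (Φ K θ E hE x)) ∧
      (∀ (K K' : Type u) [Field K] [Field K'] [Algebra k K] [Algebra k K'] [Algebra K K']
        [IsScalarTower k K K'] (θ : K) (E : TMotif.ModuleScheme k[X] (Spec (CommRingCat.of K)))
        (hE : E.IsAbelian θ)
        (hE' : (E.baseChange (TMotif.ModuleScheme.specMap K K')).IsAbelian (algebraMap K K' θ))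
        (S : TMotif.ModuleScheme.Extension E)
        (S' : TMotif.ModuleScheme.Extension (E.baseChange (TMotif.ModuleScheme.specMap K K'))),
        S.IsBaseChange S' → ∀ x : E.points K, Φ K θ E hE x = S.extClass →
          Φ K' (algebraMap K K' θ) (E.baseChange (TMotif.ModuleScheme.specMap K K')) hE'
            (E.pointsBaseChange K' x) = S'.extClass) := by
  refine ⟨fun K _ _ θ E hE => LinearEquiv.ofBijective E.pointExt hE.pointExt_bijective,
    fun K _ _ θ E F hE hF φ x => TMotif.ModuleScheme.pointExt_comp φ x,
    fun K K' _ _ _ _ _ _ θ E hE hE' S S' hS x hx =>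
      TMotif.ModuleScheme.pointExt_baseChange hE hE' S S' hS x hx⟩
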